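/- Let $\mathcal A$ be a finite alphabet with $|\mathcal A|\ge 2$ and let $\eta\colon\mathbb Z^2\to\mathcal A$. For $\vec u\in\mathbb Z^2$ put $(T^{\vec u}\eta)(\vec x)=\eta(\vec x+\vec u)$, and let $X_\eta$ be the closure of $\{T^{\vec u}\eta:\vec u\in\mathbb Z^2\}$ in $\mathcal A^{\mathbb Z^2}$ (product topology, $\mathcal A$ discrete). For a finite set $S\subset\mathbb Z^2$ let $P_\eta(S)$ be the number of distinct restrictions $(T^{\vec u}\eta)|_S$, $\vec u\in\mathbb Z^2$, and let $D_\eta(S)=P_\eta(S)-|S|$. Let $R_{n,3}=\{0,\dots,n-1\}\times\{0,1,2\}$. A point $x\in S$ is *$\eta$-generated by $S$* if, whenever $\vec u\in\mathbb Z^2$ and $\beta\in X_\eta$ are such that $T^{\vec u}\eta$ and $\beta$ agree on $S\setminus\{x\}$, they agree on $S$. The set $S$ is *convex* if $S=\operatorname{conv}(S)\cap\mathbb Z^2$. If $\operatorname{conv}(S)$ has positive area, its boundary edges are oriented counterclockwise (so that $S$ lies to the left of each edge); if it has zero area, $S$ has no edges. An edge is *parallel* to a directed line $\ell$ if it has the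 same direction and the same orientation as $\ell$. A directed line $\ell$ is a *nonexpansive direction for $\eta$* if there are $f\neq g$ in $X_\eta$ that agree at all integer points of the closed half-plane lying to the left of the translate of $\ell$ through the origin. The configuration $\eta$ is *aperiodic* if there is no $\vec m\in\mathbb Z^2\setminus\{\vec 0\}$ with $\eta(\vec x+\vec m)=\eta(\vec x)$ for all $\vec x\in\mathbb Z^2$. **Proposition.** Suppose that there exists $n\in\mathbb N$ such that $P_\eta(R_{n,3})\le 3n$, that $\ell$ is a nonexpansive direction for $\eta$, and that $\eta$ is aperiodic. Then there exists an $\ell$-balanced set, that is, a finite convex set $S\subset\mathbb Z^2$ with the following properties: 1. there is a boundary edge $w$ of $S$ that is parallel to $\ell$; 2. both endpoints of $w$ are $\eta$-generated by $S$; 3. $D_\eta(S\setminus w)>D_\eta(S)$; 4. every line parallel to $\ell$ that has nonempty intersection with $S$ contains at least $|w\cap S|-1$ points of $S$. -/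

import Mathlib

open MeasureTheory

namespace Nivat

/-- The inclusion of the integer lattice in the plane. -/
def toPlane (p : ℤ × ℤ) : ℝ × ℝ := ((p.1 : ℝ), (p.2 : ℝ))

/-- The determinant `det (v, w)`; it is nonnegative iff `w` lies weakly to the left of `v`. -/
def cross (v w : ℝ × ℝ) : ℝ := v.1 * w.2 - v.2 * w.1

section Configurations

variable {A : Type*}

/-- The translate `T^u η`, given by `(T^u η)(x) = η (x + u)`. -/
def shift (u : ℤ × ℤ) (η : ℤ × ℤ → A) : ℤ × ℤ → A := fun x => η (x + u)

/-- `η` has a nonzero period vector. -/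
def Periodic (η : ℤ × ℤ → A) : Prop :=
  ∃ m : ℤ × ℤ, m ≠ 0 ∧ ∀ x, η (x + m) = η x

/-- The `S`-words of `η`: all restrictions `(T^u η)|_S`. -/
def words (η : ℤ × ℤ → A) (S : Set (ℤ × ℤ)) : Set (S → A) :=
  Set.range fun u : ℤ × ℤ => S.domRestrict (shift u η)

/-- The complexity `P_η(S)` (used for finite `S` and a finite alphabet). -/
noncomputable def complexity (η : ℤ × ℤ → A) (S : Set (ℤ × ℤ)) : ℕ :=
  (words η S).ncard

/-- The discrepancy `D_η(S) = P_η(S) - |S|` (used for finite nonempty `S`). -/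
noncomputable def discrepancy (η : ℤ × ℤ → A) (S : Set (ℤ × ℤ)) : ℤ :=
  (complexity η S : ℤ) - (S.ncard : ℤ)

/-- The `n` by `k` rectangle `R_{n,k}`, of width `n` and height `k`. -/
def rect (n k : ℕ) : Set (ℤ × ℤ) := Set.Ico (0 : ℤ) n ×ˢ Set.Ico (0 : ℤ) k

/-- The orbit closure `X_η` for the product topology. -/
def orbitClosure [TopologicalSpace A] (η : ℤ × ℤ → A) : Set (ℤ × ℤ → A) :=
  closure (Set.range fun u : ℤ × ℤ => shift u η)

/-- The restriction of `α` to `S₁` extends uniquely to an `η`-coloring of `S₂`. -/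
def ExtendsUniquely [TopologicalSpace A] (η α : ℤ × ℤ → A) (S₁ S₂ : Set (ℤ × ℤ)) : Prop :=
  ∀ β ∈ orbitClosure η, Set.EqOn α β S₁ → Set.EqOn α β S₂

/-- `x ∈ S` is `η`-generated by `S`: every `η`-coloring of `S ∖ {x}` extends uniquely to an
`η`-coloring of `S`. -/
def IsGenerated [TopologicalSpace A] (η : ℤ × ℤ → A) (S : Set (ℤ × ℤ)) (x : ℤ × ℤ) : Prop :=
  x ∈ S ∧ ∀ u : ℤ × ℤ, ExtendsUniquely η (shift u η) (S \ {x}) S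

end Configurations

section Geometry

/-- The convex hull in the plane of a set of lattice points. -/
def hull (S : Set (ℤ × ℤ)) : Set (ℝ × ℝ) := convexHull ℝ (toPlane '' S)

/-- `S` is convex: it consists of all lattice points of its convex hull. -/
def IsLatticeConvex (S : Set (ℤ × ℤ)) : Prop := S = toPlane ⁻¹' hull S

/-- The boundary vertices of `S`. -/
def vertices (S : Set (ℤ × ℤ)) : Set (ℤ × ℤ) :=
  {p | toPlane p ∈ (hull S).extremePoints ℝ}

/-- The segment from `p` to `q` is a boundary edge of `S`, directed from `p` to `q` by the
positive (counterclockwise) orientation of the boundary, that is, with `S` on its left.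
There are no edges if the convex hull has zero area. -/
def IsBoundaryEdge (S : Set (ℤ × ℤ)) (p q : ℤ × ℤ) : Prop :=
  0 < volume (hull S) ∧ p ∈ vertices S ∧ q ∈ vertices S ∧ p ≠ q ∧
    ∀ s ∈ S, 0 ≤ cross (toPlane q - toPlane p) (toPlane s - toPlane p)

/-- The lattice points on the closed segment from `p` to `q`. -/
def latticeSegment (p q : ℤ × ℤ) : Set (ℤ × ℤ) :=
  toPlane ⁻¹' segment ℝ (toPlane p) (toPlane q)

/-- A directed line in the plane, given by a point on it and a direction vector. -/
structure DirectedLine where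
  base : ℝ × ℝ
  dir : ℝ × ℝ
  dir_ne_zero : dir ≠ 0

/-- The undirected line through `c` parallel to `ℓ`. -/
def DirectedLine.through (ℓ : DirectedLine) (c : ℝ × ℝ) : Set (ℝ × ℝ) :=
  {x | ∃ t : ℝ, x = c + t • ℓ.dir}

/-- The half-plane `H(ℓ)` whose positively oriented boundary passes through the origin and is
parallel to `ℓ`: the closed half-plane to the left of the translate of `ℓ` through the origin. -/
def DirectedLine.halfPlane (ℓ : DirectedLine) : Set (ℝ × ℝ) :=
  {x | 0 ≤ cross ℓ.dir x}

/-- The directed segment from `p` to `q` is parallel to `ℓ`, with the same orientation. -/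
def DirectedLine.ParallelTo (ℓ : DirectedLine) (p q : ℤ × ℤ) : Prop :=
  ∃ c : ℝ, 0 < c ∧ toPlane q - toPlane p = c • ℓ.dir

end Geometry

section Balanced

variable {A : Type*} [TopologicalSpace A]

/-- `ℓ` is a nonexpansive direction for `η`. -/
def IsNonexpansiveDirection (η : ℤ × ℤ → A) (ℓ : DirectedLine) : Prop :=
  ∃ f ∈ orbitClosure η, ∃ g ∈ orbitClosure η,
    f ≠ g ∧ Set.EqOn f g (toPlane ⁻¹' ℓ.halfPlane)

/-- `S` is an `ℓ`-balanced set for `η`; here `w` is the edge from `p` to `q`. -/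
def IsBalanced (η : ℤ × ℤ → A) (ℓ : DirectedLine) (S : Set (ℤ × ℤ)) : Prop :=
  S.Finite ∧ IsLatticeConvex S ∧
    ∃ p q : ℤ × ℤ, IsBoundaryEdge S p q ∧ ℓ.ParallelTo p q ∧
      IsGenerated η S p ∧ IsGenerated η S q ∧
      discrepancy η S < discrepancy η (S \ latticeSegment p q) ∧
      ∀ c : ℝ × ℝ, (toPlane ⁻¹' ℓ.through c ∩ S).Nonempty →
        (latticeSegment p q ∩ S).ncard - 1 ≤ (toPlane ⁻¹' ℓ.through c ∩ S).ncard

end Balanced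

end Nivat

open Nivat

/-! Suppose there is no balanced set; then every rectangle of height three satisfies `n * 3 <
complexity η (rect n 3)`. A lattice basis turns the direction of the line into the vertical one,
with the half-plane of agreement on the right, and complexity is bounded below by removing leftmost
columns.

The engine is `complexity_add_ncard_slice_le`. Nonexpansiveness makes the first point added to the
left of a set increase the complexity. If a whole leftmost column of `k` points increases it by less
than `k`, a shortest subsegment with this defect has both endpoints generated, and is the edge of a
balanced set, provided the other columns have at least `k - 1` points. Thus, if columns never shrink
by more than one point to the right, all columns can be removed. The last one is handled by the
Morse-Hedlund argument, and the discrepancy is positive (`ncard_lt_complexity`).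

If the direction separates the points of the rectangle, they can be removed one by one. Otherwise it
is `(1, 0)`, `(2m + 1, 2)` or `(α, 1)` up to a scalar. The first two give columns of almost equal
length. In the third case the rectangle is sheared, and columns of three points may stand to the
left of columns of one point. The lowest row is therefore shortened until the columns are good, and
its points are restored one at a time (`ncard_shearedRect_lt_complexity`).

A failure while restoring them produces a trapezoid with two generated left vertices, a generated
right tip and at most two exceptional words (`ncard_trapezoid_lt_complexity`). Eight translates of
it are stacked into a tall trapezoid. The engine forces at least nine exceptional words when a
column of nine points is added. Each is recorded by a binary code of length eight, and only eight
codes have fewer than three distinct two-letter factors. A code with three such factors is so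
irregular that everything near it is forced to be vertically constant, up to swapping the two
configurations. This constancy spreads to the left until two windows agree except at the tip, where
they differ, against its being generated (`CodedPair.contradiction`). -/

namespace Nivat

/-! ### Words, complexity and exceptional extensions. -/

section Words

variable {A : Type*}

/-- The patterns of `η` seen at `z` and at `z'` through the window `T` coincide. -/
def Agree (η : ℤ × ℤ → A) (T : Set (ℤ × ℤ)) (z z' : ℤ × ℤ) : Prop :=
  ∀ p ∈ T, η (p + z) = η (p + z')

/-- The `T`-word of `η` at `z`. -/
def wordAt (η : ℤ × ℤ → A) (T : Set (ℤ × ℤ)) (z : ℤ × ℤ) : T → A :=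
  T.domRestrict (shift z η)

theorem wordAt_eq_iff {η : ℤ × ℤ → A} {T : Set (ℤ × ℤ)} {z z' : ℤ × ℤ} :
    wordAt η T z = wordAt η T z' ↔ Agree η T z z' := by
  constructor
  · intro h p hp
    exact congrFun h ⟨p, hp⟩
  · intro h
    funext p
    exact h p.1 p.2

theorem Agree.refl (η : ℤ × ℤ → A) (T : Set (ℤ × ℤ)) (z : ℤ × ℤ) : Agree η T z z :=
  fun _ _ => rfl

theorem Agree.symm {η : ℤ × ℤ → A} {T : Set (ℤ × ℤ)} {z z' : ℤ × ℤ} (h : Agree η T z z') :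
    Agree η T z' z := fun p hp => (h p hp).symm

theorem Agree.trans {η : ℤ × ℤ → A} {T : Set (ℤ × ℤ)} {z z' z'' : ℤ × ℤ}
    (h : Agree η T z z') (h' : Agree η T z' z'') : Agree η T z z'' :=
  fun p hp => (h p hp).trans (h' p hp)

theorem Agree.mono {η : ℤ × ℤ → A} {S T : Set (ℤ × ℤ)} {z z' : ℤ × ℤ} (h : Agree η T z z')
    (hST : S ⊆ T) : Agree η S z z' := fun p hp => h p (hST hp)

/-- A representative of the class of positions at which the same `V`-word is seen. -/
noncomputable def canonical (η : ℤ × ℤ → A) (V : Set (ℤ × ℤ)) (z : ℤ × ℤ) : ℤ × ℤ :=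
  Function.invFun (wordAt η V) (wordAt η V z)

theorem agree_canonical (η : ℤ × ℤ → A) (V : Set (ℤ × ℤ)) (z : ℤ × ℤ) :
    Agree η V (canonical η V z) z :=
  wordAt_eq_iff.1 (Function.invFun_eq ⟨z, rfl⟩)

theorem canonical_eq {η : ℤ × ℤ → A} {V : Set (ℤ × ℤ)} {z z' : ℤ × ℤ} (h : Agree η V z z') :
    canonical η V z = canonical η V z' := by
  unfold canonical
  rw [wordAt_eq_iff.2 h]

/-- The `S`-word at `z` is not the chosen extension of the `V`-word at `z`. -/
def IsExceptional (η : ℤ × ℤ → A) (V S : Set (ℤ × ℤ)) (z : ℤ × ℤ) : Prop :=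
  ¬ Agree η S (canonical η V z) z

/-- The exceptional `S`-words. -/
def exceptional (η : ℤ × ℤ → A) (V S : Set (ℤ × ℤ)) : Set (S → A) :=
  wordAt η S '' {z | IsExceptional η V S z}

/-- Serves both for translations of the window and for changes of the lattice basis: `e` transports
windows and `k` positions. -/
theorem complexity_congr {η η' : ℤ × ℤ → A} (e k : ℤ × ℤ → ℤ × ℤ) (he : Function.Surjective e)
    (hk : Function.Surjective k) (h : ∀ p z, η' (p + z) = η (e p + k z)) (T : Set (ℤ × ℤ)) :
    complexity η' (e ⁻¹' T) = complexity η T := by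
  set F : (T → A) → (e ⁻¹' T : Set (ℤ × ℤ)) → A := fun w p => w ⟨e p.1, p.2⟩ with hF
  have hinj : Function.Injective F := by
    intro w w' hw
    funext ⟨q, hq⟩
    obtain ⟨p, rfl⟩ := he q
    exact congrFun hw ⟨p, hq⟩
  have h1 : words η' (e ⁻¹' T) = F '' words η T := by
    ext w
    constructor
    · rintro ⟨z, rfl⟩
      refine ⟨_, ⟨k z, rfl⟩, ?_⟩
      funext p
      exact (h p.1 z).symm
    · rintro ⟨_, ⟨z, rfl⟩, rfl⟩
      obtain ⟨y, rfl⟩ := hk z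
      refine ⟨y, ?_⟩
      funext p
      exact h p.1 y
  unfold complexity
  rw [h1, Set.ncard_image_of_injective _ hinj]

theorem complexity_translate (η : ℤ × ℤ → A) (v : ℤ × ℤ) (T : Set (ℤ × ℤ)) :
    complexity η {p | p + v ∈ T} = complexity η T := by
  refine complexity_congr (fun p => p + v) (fun z => z - v) (fun q => ⟨q - v, by simp⟩)
    (fun q => ⟨q + v, by simp⟩) (fun p z => ?_) T
  congr 1
  abel

variable [Finite A]

theorem words_finite (η : ℤ × ℤ → A) {T : Set (ℤ × ℤ)} (hT : T.Finite) :
    (words η T).Finite := by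
  have := hT.to_subtype
  exact Set.toFinite _

theorem exceptional_finite (η : ℤ × ℤ → A) (V : Set (ℤ × ℤ)) {S : Set (ℤ × ℤ)} (hS : S.Finite) :
    (exceptional η V S).Finite := by
  have := hS.to_subtype
  exact Set.toFinite _

/-- The `S`-words split into one chosen extension of each `V`-word and the exceptional words, so the
growth of the complexity counts the latter. -/
theorem complexity_eq_add (η : ℤ × ℤ → A) {V S : Set (ℤ × ℤ)} (hVS : V ⊆ S) (hS : S.Finite) :
    complexity η S = complexity η V + (exceptional η V S).ncard := by
  set F : (V → A) → (S → A) := fun w => wordAt η S (Function.invFun (wordAt η V) w) with hF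
  have h1 : words η S = F '' words η V ∪ exceptional η V S := by
    ext w
    constructor
    · rintro ⟨z, rfl⟩
      by_cases h : IsExceptional η V S z
      · exact Or.inr ⟨z, h, rfl⟩
      · exact Or.inl ⟨wordAt η V z, ⟨z, rfl⟩, wordAt_eq_iff.2 (not_not.1 h)⟩
    · rintro (⟨_, ⟨z, rfl⟩, rfl⟩ | ⟨z, _, rfl⟩)
      · exact ⟨_, rfl⟩
      · exact ⟨_, rfl⟩
  have h2 : Disjoint (F '' words η V) (exceptional η V S) := by
    rw [Set.disjoint_left]
    rintro _ ⟨_, ⟨z, rfl⟩, rfl⟩ ⟨z', hz', he⟩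
    have he' : Agree η S z' (canonical η V z) := wordAt_eq_iff.1 he
    have : canonical η V z' = canonical η V z :=
      canonical_eq ((he'.mono hVS).trans (agree_canonical η V z))
    exact hz' (this ▸ he'.symm)
  have h3 : Set.InjOn F (words η V) := by
    rintro _ ⟨z, rfl⟩ _ ⟨z', rfl⟩ h
    have h' : Agree η S (canonical η V z) (canonical η V z') := wordAt_eq_iff.1 h
    exact wordAt_eq_iff.2 (((agree_canonical η V z).symm.trans (h'.mono hVS)).trans
      (agree_canonical η V z'))
  unfold complexity
  rw [h1, Set.ncard_union_eq h2 ((words_finite η (hS.subset hVS)).image _)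
    (exceptional_finite η V hS), h3.ncard_image]

theorem complexity_mono (η : ℤ × ℤ → A) {V S : Set (ℤ × ℤ)} (hVS : V ⊆ S) (hS : S.Finite) :
    complexity η V ≤ complexity η S := by
  rw [complexity_eq_add η hVS hS]
  exact Nat.le_add_right _ _

/-- Without growth there are no exceptional words, so restriction from `S`-words to `V`-words is
injective. -/
theorem agree_of_complexity_le {η : ℤ × ℤ → A} {V S : Set (ℤ × ℤ)} (hVS : V ⊆ S)
    (hS : S.Finite) (h : complexity η S ≤ complexity η V) {z z' : ℤ × ℤ}
    (hz : Agree η V z z') : Agree η S z z' := by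
  rw [complexity_eq_add η hVS hS] at h
  have h0 : (exceptional η V S).ncard = 0 := by omega
  rw [Set.ncard_eq_zero (exceptional_finite η V hS)] at h0
  have h1 : ∀ z, Agree η S (canonical η V z) z := by
    intro z
    by_contra hc
    have : wordAt η S z ∈ exceptional η V S := ⟨z, hc, rfl⟩
    rw [h0] at this
    exact this
  have h2 := h1 z
  rw [canonical_eq hz] at h2
  exact h2.symm.trans (h1 z')

theorem complexity_lt_of_not_agree {η : ℤ × ℤ → A} {V S : Set (ℤ × ℤ)} (hVS : V ⊆ S)
    (hS : S.Finite) {z z' : ℤ × ℤ} (hz : Agree η V z z') (hn : ¬ Agree η S z z') :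
    complexity η V < complexity η S := by
  by_contra hc
  exact hn (agree_of_complexity_le hVS hS (not_lt.1 hc) hz)

/-- Among more exceptional positions than there are exceptional words, two see the same word. -/
theorem exists_agree_of_lt {η : ℤ × ℤ → A} {V S : Set (ℤ × ℤ)} (hVS : V ⊆ S)
    (hS : S.Finite) {k m : ℕ} (h : complexity η S ≤ complexity η V + k) (hkm : k < m)
    (f : Fin m → ℤ × ℤ) (hf : ∀ i, IsExceptional η V S (f i)) :
    ∃ i j, i < j ∧ Agree η S (f i) (f j) := by
  by_contra! hc
  have hinj : Function.Injective fun i => wordAt η S (f i) := by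
    intro i j hij
    rcases lt_trichotomy i j with hlt | heq | hlt
    · exact absurd (wordAt_eq_iff.1 hij) (hc i j hlt)
    · exact heq
    · exact absurd (wordAt_eq_iff.1 hij.symm) (hc j i hlt)
  have h1 : (Set.range fun i => wordAt η S (f i)).ncard = m := by
    rw [← Set.image_univ, Set.ncard_image_of_injective _ hinj, Set.ncard_univ]
    simp
  have h2 : (Set.range fun i => wordAt η S (f i)) ⊆ exceptional η V S := by
    rintro _ ⟨i, rfl⟩
    exact ⟨f i, hf i, rfl⟩
  have h3 := Set.ncard_le_ncard h2 (exceptional_finite η V hS)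
  rw [complexity_eq_add η hVS hS] at h
  omega

/-- The complexity grows by at most `k` if the exceptional words are classified by `k` labels. -/
theorem complexity_le_add_of_labels {η : ℤ × ℤ → A} {V S : Set (ℤ × ℤ)} (hVS : V ⊆ S)
    (hS : S.Finite) {κ : Type*} [Finite κ] (K : ℤ × ℤ → κ) {C : Set κ}
    (hC : ∀ z, IsExceptional η V S z → K z ∈ C)
    (hK : ∀ z z', IsExceptional η V S z → IsExceptional η V S z' → K z = K z' →
      Agree η S z z') :
    complexity η S ≤ complexity η V + C.ncard := by
  rw [complexity_eq_add η hVS hS]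
  refine Nat.add_le_add_left ?_ _
  choose! g hg using fun (w : S → A) (hw : w ∈ exceptional η V S) => hw
  refine Set.ncard_le_ncard_of_injOn (fun w => K (g w)) (fun w hw => hC _ (hg w hw).1) ?_
    (Set.toFinite C)
  intro w hw w' hw' h
  rw [← (hg w hw).2, ← (hg w' hw').2]
  exact wordAt_eq_iff.2 (hK _ _ (hg w hw).1 (hg w' hw').1 h)

theorem one_le_complexity (η : ℤ × ℤ → A) {T : Set (ℤ × ℤ)} (hT : T.Finite) :
    1 ≤ complexity η T := by
  have : (words η T).Nonempty := ⟨_, 0, rfl⟩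
  exact (Set.ncard_pos (words_finite η hT)).2 this

/-- The vertical segment of `k` points that starts at the origin. -/
def column (k : ℕ) : Set (ℤ × ℤ) := {p | p.1 = 0 ∧ 0 ≤ p.2 ∧ p.2 < k}

theorem column_finite (k : ℕ) : (column k).Finite := by
  refine ((Set.finite_singleton (0 : ℤ)).prod (Set.finite_Ico (0 : ℤ) k)).subset ?_
  rintro ⟨x, y⟩ ⟨h1, h2, h3⟩
  exact ⟨h1, h2, h3⟩

/-- If the column words do not multiply, a word of `k` letters determines the letters directly above
and below it. Any repetition on a vertical line then propagates in both directions. -/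
theorem periodic_of_complexity_column_le (η : ℤ × ℤ → A) (k : ℕ)
    (h : complexity η (column (k + 1)) ≤ complexity η (column k)) : Periodic η := by
  have hsub : column k ⊆ column (k + 1) := by
    rintro ⟨x, y⟩ ⟨h1, h2, h3⟩
    refine ⟨h1, h2, ?_⟩
    push_cast
    omega
  have hup : ∀ z z', Agree η (column k) z z' → Agree η (column (k + 1)) z z' :=
    fun z z' hz => agree_of_complexity_le hsub (column_finite _) h hz
  have hsub' : {p : ℤ × ℤ | p + (0, -1) ∈ column k} ⊆ column (k + 1) := by
    rintro ⟨x, y⟩ ⟨h1, h2, h3⟩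
    simp only [Prod.mk_add_mk] at h1 h2 h3
    refine ⟨by omega, ?_, ?_⟩
    · show 0 ≤ y
      omega
    · show y < ((k + 1 : ℕ) : ℤ)
      push_cast
      omega
  have hdown : ∀ z z', Agree η {p : ℤ × ℤ | p + (0, -1) ∈ column k} z z' →
      Agree η (column (k + 1)) z z' := fun z z' hz =>
    agree_of_complexity_le hsub' (column_finite _) (by rwa [complexity_translate]) hz
  have stepUp : ∀ z z', Agree η (column k) z z' →
      Agree η (column k) (z + (0, 1)) (z' + (0, 1)) := by
    rintro z z' hz ⟨x, y⟩ ⟨h1, h2, h3⟩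
    have := hup z z' hz (x, y + 1) ⟨h1, by simp only at h2 ⊢; omega, by
      push_cast; simp only at h3 ⊢; omega⟩
    have e : ∀ w : ℤ × ℤ, (x, y) + (w + (0, 1)) = (x, y + 1) + w := by
      intro w; ext <;> simp <;> ring
    rw [e, e]
    exact this
  have stepDown : ∀ z z', Agree η (column k) z z' →
      Agree η (column k) (z - (0, 1)) (z' - (0, 1)) := by
    intro z z' hz
    have h1 : Agree η {p : ℤ × ℤ | p + (0, -1) ∈ column k} (z - (0, 1)) (z' - (0, 1)) := by
      rintro p hp
      have := hz _ hp
      have e : ∀ w : ℤ × ℤ, p + (w - (0, 1)) = p + (0, -1) + w := by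
        intro w; ext <;> simp <;> ring
      rw [e, e]
      exact this
    exact (hdown _ _ h1).mono hsub
  set M := (words η (column k)).ncard with hM
  -- Among `M + 1` positions on one vertical line two show the same word, so every line has a period
  -- of at most `M`, a bound independent of the line.
  have key : ∀ x : ℤ, ∃ d : ℕ, 0 < d ∧ d ≤ M ∧ ∀ y : ℤ, η (x, y + d) = η (x, y) := by
    intro x
    have hmaps : Set.MapsTo (fun i : ℕ => wordAt η (column k) (x, (i : ℤ)))
        (Finset.range (M + 1) : Set ℕ) (words η (column k)) := fun i _ => ⟨_, rfl⟩
    obtain ⟨i, hi, j, hj, hij, he⟩ : ∃ i ∈ (Finset.range (M + 1) : Set ℕ),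
        ∃ j ∈ (Finset.range (M + 1) : Set ℕ), i ≠ j ∧
        wordAt η (column k) (x, (i : ℤ)) = wordAt η (column k) (x, (j : ℤ)) := by
      refine Set.exists_ne_map_eq_of_ncard_lt_of_maps_to ?_ hmaps
        (words_finite η (column_finite k))
      rw [Set.ncard_coe_finset, Finset.card_range]
      omega
    wlog hlt : i < j generalizing i j
    · exact this j hj i hi hij.symm he.symm (by omega)
    simp only [Finset.coe_range, Set.mem_Iio] at hi hj
    have he' := wordAt_eq_iff.1 he
    refine ⟨j - i, by omega, by omega, ?_⟩
    have hu : ∀ n : ℕ, Agree η (column k) (x, (i : ℤ) + n) (x, (j : ℤ) + n) := by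
      intro n
      induction n with
      | zero => simpa using he'
      | succ n ih =>
        have := stepUp _ _ ih
        simpa [add_assoc] using this
    have hd : ∀ n : ℕ, Agree η (column k) (x, (i : ℤ) - n) (x, (j : ℤ) - n) := by
      intro n
      induction n with
      | zero => simpa using he'
      | succ n ih =>
        have := stepDown _ _ ih
        simpa [sub_sub] using this
    have hall : ∀ y : ℤ, Agree η (column k) (x, y) (x, y + ((j - i : ℕ) : ℤ)) := by
      intro y
      rcases le_total (i : ℤ) y with hy | hy
      · have := hu (y - i).toNat
        have e1 : ((i : ℤ) + ((y - i).toNat : ℤ)) = y := by omega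
        have e2 : ((j : ℤ) + ((y - i).toNat : ℤ)) = y + ((j - i : ℕ) : ℤ) := by omega
        rwa [e1, e2] at this
      · have := hd (i - y).toNat
        have e1 : ((i : ℤ) - ((i - y).toNat : ℤ)) = y := by omega
        have e2 : ((j : ℤ) - ((i - y).toNat : ℤ)) = y + ((j - i : ℕ) : ℤ) := by omega
        rwa [e1, e2] at this
    intro y
    have := hup _ _ (hall (y - k)) (0, k) ⟨rfl, by simp, by push_cast; simp⟩
    simp only [Prod.mk_add_mk, zero_add] at this
    have e1 : (k : ℤ) + (y - k) = y := by ring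
    have e2 : (k : ℤ) + (y - k + ((j - i : ℕ) : ℤ)) = y + ((j - i : ℕ) : ℤ) := by ring
    rw [e1, e2] at this
    exact this.symm
  -- The periods of the lines may differ, but all of them divide `M!`.
  refine ⟨(0, (M.factorial : ℤ)), ?_, ?_⟩
  · intro h0
    have := congrArg Prod.snd h0
    simp only [Prod.snd_zero, Nat.cast_eq_zero] at this
    exact M.factorial_ne_zero this
  · rintro ⟨x, y⟩
    obtain ⟨d, hd0, hdM, hd⟩ := key x
    obtain ⟨c, hc⟩ := Nat.dvd_factorial hd0 hdM
    have hmul : ∀ n : ℕ, η (x, y + (n * d : ℕ)) = η (x, y) := by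
      intro n
      induction n with
      | zero => simp
      | succ n ih =>
        rw [← ih, ← hd (y + (n * d : ℕ))]
        congr 2
        push_cast
        ring
    have := hmul c
    rw [mul_comm c d, ← hc] at this
    simpa using this

/-- A form of the Morse-Hedlund theorem for the columns of `η`. -/
theorem lt_complexity_column {η : ℤ × ℤ → A} (h : ¬ Periodic η) (k : ℕ) :
    k < complexity η (column k) := by
  induction k with
  | zero => exact one_le_complexity η (column_finite 0)
  | succ k ih =>
    by_contra hc
    exact h (periodic_of_complexity_column_le η k (by omega))

end Words

end Nivat

namespace Nivat

/-! ### Lattice-convex sets and their columns. -/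

section LatticeConvex

/-- `T` consists of the lattice points of some convex set. -/
def IsConvexLattice (T : Set (ℤ × ℤ)) : Prop :=
  ∃ C : Set (ℝ × ℝ), Convex ℝ C ∧ ∀ p, p ∈ T ↔ toPlane p ∈ C

theorem IsConvexLattice.inter {S T : Set (ℤ × ℤ)} (hS : IsConvexLattice S)
    (hT : IsConvexLattice T) : IsConvexLattice (S ∩ T) := by
  obtain ⟨C, hC, h⟩ := hS
  obtain ⟨D, hD, h'⟩ := hT
  exact ⟨C ∩ D, hC.inter hD, fun p => and_congr (h p) (h' p)⟩

theorem isConvexLattice_halfPlane (α β γ : ℤ) :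
    IsConvexLattice {p | α * p.1 + β * p.2 ≤ γ} := by
  refine ⟨{q | (α : ℝ) * q.1 + β * q.2 ≤ γ}, convex_halfSpace_le ?_ _, fun p => ?_⟩
  · constructor
    · intro x y
      simp only [Prod.fst_add, Prod.snd_add]
      ring
    · intro c x
      simp only [Prod.smul_fst, Prod.smul_snd, smul_eq_mul]
      ring
  · simp only [Set.mem_ofPred_eq, toPlane]
    exact_mod_cast Iff.rfl

theorem IsConvexLattice.mem_of_mem_of_mem {T : Set (ℤ × ℤ)} (hT : IsConvexLattice T)
    {x a b y : ℤ} (ha : (x, a) ∈ T) (hb : (x, b) ∈ T) (hay : a ≤ y) (hyb : y ≤ b) :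
    (x, y) ∈ T := by
  obtain ⟨C, hC, h⟩ := hT
  rcases eq_or_lt_of_le (hay.trans hyb) with hab | hab
  · obtain rfl : y = a := by omega
    exact ha
  rw [h] at ha hb ⊢
  have hpos : (0 : ℝ) < b - a := by
    have : (a : ℝ) < b := by exact_mod_cast hab
    linarith
  have h1 : (0 : ℝ) ≤ (b - y) / (b - a) := by
    have : (y : ℝ) ≤ b := by exact_mod_cast hyb
    exact div_nonneg (by linarith) hpos.le
  have h2 : (0 : ℝ) ≤ (y - a) / (b - a) := by
    have : (a : ℝ) ≤ y := by exact_mod_cast hay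
    exact div_nonneg (by linarith) hpos.le
  have h3 : ((b : ℝ) - y) / (b - a) + (y - a) / (b - a) = 1 := by
    field_simp
    ring
  have := hC ha hb h1 h2 h3
  convert this using 1
  simp only [toPlane, Prod.smul_mk, smul_eq_mul, Prod.mk_add_mk]
  ext
  · simp only
    rw [← add_mul, h3, one_mul]
  · simp only
    field_simp
    ring

/-- The points of `T` with first coordinate `x`. -/
def slice (T : Set (ℤ × ℤ)) (x : ℤ) : Set (ℤ × ℤ) := {p | p ∈ T ∧ p.1 = x}

theorem slice_subset (T : Set (ℤ × ℤ)) (x : ℤ) : slice T x ⊆ T := fun _ h => h.1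

/-- The vertical segment from `(x, a)` to `(x, b)`. -/
def vseg (x a b : ℤ) : Set (ℤ × ℤ) := {p | p.1 = x ∧ a ≤ p.2 ∧ p.2 ≤ b}

theorem vseg_eq_image (x a b : ℤ) : vseg x a b = (fun y : ℤ => (x, y)) '' Set.Icc a b := by
  ext ⟨x', y⟩
  constructor
  · rintro ⟨h, h1, h2⟩
    simp only at h h1 h2
    exact ⟨y, ⟨h1, h2⟩, by rw [h]⟩
  · rintro ⟨y', ⟨h1, h2⟩, h⟩
    simp only [Prod.mk.injEq] at h
    obtain ⟨rfl, rfl⟩ := h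
    exact ⟨rfl, h1, h2⟩

theorem vseg_finite (x a b : ℤ) : (vseg x a b).Finite := by
  rw [vseg_eq_image]
  exact (Set.finite_Icc a b).image _

theorem ncard_vseg (x : ℤ) {a b : ℤ} (hab : a ≤ b + 1) : ((vseg x a b).ncard : ℤ) = b - a + 1 := by
  rw [vseg_eq_image, Set.ncard_image_of_injective _ (fun y y' h => (Prod.mk.inj h).2)]
  rw [← Finset.coe_Icc, Set.ncard_coe_finset, Int.card_Icc]
  omega

theorem IsConvexLattice.slice_eq_vseg {T : Set (ℤ × ℤ)} (hT : IsConvexLattice T)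
    (hfin : T.Finite) {x : ℤ} (hx : (slice T x).Nonempty) :
    ∃ a b, a ≤ b ∧ slice T x = vseg x a b := by
  have hf : (slice T x).Finite := hfin.subset (slice_subset T x)
  obtain ⟨p, hp, hpmin⟩ := Set.exists_min_image _ Prod.snd hf hx
  obtain ⟨q, hq, hqmax⟩ := Set.exists_max_image _ Prod.snd hf hx
  refine ⟨p.2, q.2, hpmin q hq, ?_⟩
  ext ⟨x', y⟩
  constructor
  · intro h
    exact ⟨h.2, hpmin _ h, hqmax _ h⟩
  · rintro ⟨h, h1, h2⟩
    simp only at h h1 h2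
    subst h
    refine ⟨hT.mem_of_mem_of_mem (a := p.2) (b := q.2) ?_ ?_ h1 h2, rfl⟩
    · have := hp.1
      have e : p = (x', p.2) := Prod.ext hp.2 rfl
      rwa [e] at this
    · have := hq.1
      have e : q = (x', q.2) := Prod.ext hq.2 rfl
      rwa [e] at this

end LatticeConvex

/-! ### Removing columns in the absence of balanced sets. -/

section Balanced

variable {A : Type*}

/-- Equality to the right of a vertical line does not force equality on it. -/
def IsVerticallyNonexpansive (η : ℤ × ℤ → A) : Prop :=
  ∀ (V : Set (ℤ × ℤ)) (p : ℤ × ℤ), V.Finite → (∀ v ∈ V, p.1 < v.1) →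
    ∃ z z', Agree η V z z' ∧ η (p + z) ≠ η (p + z')

/-- The letter at `p` is determined by the remaining letters of a `T`-word. -/
def Generates (η : ℤ × ℤ → A) (T : Set (ℤ × ℤ)) (p : ℤ × ℤ) : Prop :=
  ∀ z z', Agree η (T \ {p}) z z' → η (p + z) = η (p + z')

/-- There is a balanced set for the vertical direction: it lies to the right of its edge. -/
def HasVerticalBalanced (η : ℤ × ℤ → A) : Prop :=
  ∃ (T : Set (ℤ × ℤ)) (x a b : ℤ), T.Finite ∧ IsConvexLattice T ∧ a < b ∧
    (∀ p ∈ T, x ≤ p.1) ∧ slice T x = vseg x a b ∧ (∃ p ∈ T, x < p.1) ∧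
    Generates η T (x, a) ∧ Generates η T (x, b) ∧
    (complexity η T : ℤ) < complexity η (T \ vseg x a b) + (b - a + 1) ∧
    ∀ p ∈ T, b - a ≤ (slice T p.1).ncard

theorem complexity_vseg (η : ℤ × ℤ → A) (x a b : ℤ) :
    complexity η (vseg x a b) = complexity η (column (b - a + 1).toNat) := by
  rw [← complexity_translate η (-x, -a) (column (b - a + 1).toNat)]
  congr 1
  ext ⟨x', y⟩
  simp only [vseg, column, Set.mem_ofPred_eq, Prod.mk_add_mk]
  omega

variable [Finite A]

theorem generates_of_complexity_le {η : ℤ × ℤ → A} {S T : Set (ℤ × ℤ)} {p : ℤ × ℤ}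
    (hT : T.Finite) (hp : p ∈ T) (hS : S = T \ {p}) (h : complexity η T ≤ complexity η S) :
    Generates η T p := by
  subst hS
  intro z z' hz
  exact agree_of_complexity_le Set.sdiff_subset hT h hz p hp

/-- A deficient column contains a shortest deficient subsegment. Removing either endpoint leaves a
segment that is not deficient, so neither endpoint can add a word: both are generated. The column
hypothesis supplies the last property of a balanced set. -/
theorem complexity_add_ncard_slice_le {η : ℤ × ℤ → A} (hne : IsVerticallyNonexpansive η)
    (hb : ¬ HasVerticalBalanced η) {T : Set (ℤ × ℤ)} (hfin : T.Finite)
    (hconv : IsConvexLattice T) {x : ℤ} (hx : ∀ p ∈ T, x ≤ p.1) (hr : ∃ p ∈ T, x < p.1)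
    (hcol : ∀ p ∈ T, (slice T x).ncard ≤ (slice T p.1).ncard + 1) :
    complexity η {p | p ∈ T ∧ x < p.1} + (slice T x).ncard ≤ complexity η T := by
  set V : Set (ℤ × ℤ) := {p | p ∈ T ∧ x < p.1} with hV
  have hVfin : V.Finite := hfin.subset fun p h => h.1
  rcases Set.eq_empty_or_nonempty (slice T x) with he | hw
  · rw [he, Set.ncard_empty, add_zero]
    exact complexity_mono η (fun p h => h.1) hfin
  obtain ⟨lo, hi, hlohi, hslice⟩ := hconv.slice_eq_vseg hfin hw
  have hTeq : T = V ∪ vseg x lo hi := by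
    rw [← hslice]
    ext p
    constructor
    · intro hp
      rcases eq_or_lt_of_le (hx p hp) with h | h
      · exact Or.inr ⟨hp, h.symm⟩
      · exact Or.inl ⟨hp, h⟩
    · rintro (hp | hp)
      · exact hp.1
      · exact hp.1
  have hcard : ((slice T x).ncard : ℤ) = hi - lo + 1 := by
    rw [hslice, ncard_vseg x (by omega)]
  have hdisj : ∀ a b, Disjoint V (vseg x a b) := by
    intro a b
    rw [Set.disjoint_left]
    rintro p ⟨_, h1⟩ ⟨h2, _⟩
    omega
  obtain ⟨M, hM⟩ : ∃ M : ℤ, ∀ p ∈ T, |p.2| ≤ M := by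
    obtain ⟨M, hM⟩ := (hfin.image fun p : ℤ × ℤ => |p.2|).bddAbove
    exact ⟨M, fun p hp => hM ⟨p, hp, rfl⟩⟩
  -- Induction on the length of a subsegment of the leftmost column: each subsegment contributes at
  -- least one word per point.
  have main : ∀ (m : ℕ) (a b : ℤ), lo ≤ a → b ≤ hi → b - a = m →
      (complexity η V : ℤ) + (b - a + 1) ≤ complexity η (V ∪ vseg x a b) := by
    intro m
    induction m with
    | zero =>
      intro a b ha hbhi hab
      obtain rfl : b = a := by push_cast at hab; omega
      -- A single point gives a new word, by nonexpansiveness.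
      obtain ⟨z, z', hz, hn⟩ := hne V (x, b) hVfin fun v hv => hv.2
      have hlt := complexity_lt_of_not_agree (S := V ∪ vseg x b b) Set.subset_union_left
        (hVfin.union (vseg_finite _ _ _)) hz
        (fun h => hn (h _ (Or.inr ⟨rfl, le_refl _, le_refl _⟩)))
      omega
    | succ m ih =>
      intro a b ha hbhi hab
      push_cast at hab
      have ih1 := ih (a + 1) b (by omega) hbhi (by omega)
      have ih2 := ih a (b - 1) ha (by omega) (by omega)
      by_contra hc
      push Not at hc
      have hWfin : (V ∪ vseg x a b).Finite := hVfin.union (vseg_finite _ _ _)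
      have hWx : slice (V ∪ vseg x a b) x = vseg x a b := by
        ext p
        constructor
        · rintro ⟨h1 | h1, h2⟩
          · have := h1.2
            omega
          · exact h1
        · intro h
          exact ⟨Or.inr h, h.1⟩
      have hWsub : V ∪ vseg x a b ⊆ T := by
        rw [hTeq]
        refine Set.union_subset_union_right _ ?_
        rintro p ⟨h1, h2, h3⟩
        exact ⟨h1, by omega, by omega⟩
      refine hb ⟨V ∪ vseg x a b, x, a, b, hWfin, ?_, by omega, fun p hp => hx p (hWsub hp), hWx,
        ?_, ?_, ?_, ?_, ?_⟩
      -- Convexity survives the trimming of the column: two lines through its new endpoints, of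
      -- slope `K` and `-K`, are so steep that they cut off no point further right.
      · set K : ℤ := M + |a| + |b| with hK
        have : V ∪ vseg x a b = (T ∩ {p | (-K) * p.1 + (-1) * p.2 ≤ (-K) * x - a}) ∩
            {p | (-K) * p.1 + 1 * p.2 ≤ (-K) * x + b} := by
          ext p
          have hab1 := neg_abs_le a
          have hab2 := le_abs_self a
          have hab3 := neg_abs_le b
          have hab4 := le_abs_self b
          constructor
          · intro hp
            refine ⟨⟨hWsub hp, ?_⟩, ?_⟩
            · rcases hp with hp | hp
              · have h1 := abs_le.1 (hM p hp.1)
                have h2 : x + 1 ≤ p.1 := hp.2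
                have h3 : 0 ≤ K := by
                  have := (abs_nonneg p.2).trans (hM p hp.1)
                  positivity
                show (-K) * p.1 + (-1) * p.2 ≤ (-K) * x - a
                nlinarith [mul_le_mul_of_nonneg_left h2 h3]
              · obtain ⟨h1, h2, h3⟩ := hp
                show (-K) * p.1 + (-1) * p.2 ≤ (-K) * x - a
                rw [h1]
                linarith
            · rcases hp with hp | hp
              · have h1 := abs_le.1 (hM p hp.1)
                have h2 : x + 1 ≤ p.1 := hp.2
                have h3 : 0 ≤ K := by
                  have := (abs_nonneg p.2).trans (hM p hp.1)
                  positivity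
                show (-K) * p.1 + 1 * p.2 ≤ (-K) * x + b
                nlinarith [mul_le_mul_of_nonneg_left h2 h3]
              · obtain ⟨h1, h2, h3⟩ := hp
                show (-K) * p.1 + 1 * p.2 ≤ (-K) * x + b
                rw [h1]
                linarith
          · rintro ⟨⟨hp, h1⟩, h2⟩
            rw [Set.mem_ofPred_eq] at h1 h2
            rcases eq_or_lt_of_le (hx p hp) with h | h
            · rw [← h] at h1 h2
              exact Or.inr ⟨h.symm, by linarith, by linarith⟩
            · exact Or.inl ⟨hp, h⟩
        rw [this]
        exact (hconv.inter (isConvexLattice_halfPlane _ _ _)).inter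
          (isConvexLattice_halfPlane _ _ _)
      · obtain ⟨p, hp, hpx⟩ := hr
        exact ⟨p, Or.inl ⟨hp, hpx⟩, hpx⟩
      · refine generates_of_complexity_le (S := V ∪ vseg x (a + 1) b) hWfin
          (Or.inr ⟨rfl, le_refl _, by simp only; omega⟩) ?_ (by omega)
        ext p
        constructor
        · rintro (hp | ⟨h1, h2, h3⟩)
          · refine ⟨Or.inl hp, fun h => ?_⟩
            have := hp.2
            rw [Set.mem_singleton_iff.1 h] at this
            simp at this
          · refine ⟨Or.inr ⟨h1, by omega, h3⟩, fun h => ?_⟩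
            rw [Set.mem_singleton_iff.1 h] at h2
            simp only at h2
            omega
        · rintro ⟨hp | ⟨h1, h2, h3⟩, h⟩
          · exact Or.inl hp
          · have : p.2 ≠ a := fun h' => h (Prod.ext h1 h')
            exact Or.inr ⟨h1, by omega, h3⟩
      · refine generates_of_complexity_le (S := V ∪ vseg x a (b - 1)) hWfin
          (Or.inr ⟨rfl, by simp only; omega, le_refl _⟩) ?_ (by omega)
        ext p
        constructor
        · rintro (hp | ⟨h1, h2, h3⟩)
          · refine ⟨Or.inl hp, fun h => ?_⟩
            have := hp.2
            rw [Set.mem_singleton_iff.1 h] at this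
            simp at this
          · refine ⟨Or.inr ⟨h1, h2, by omega⟩, fun h => ?_⟩
            rw [Set.mem_singleton_iff.1 h] at h3
            simp only at h3
            omega
        · rintro ⟨hp | ⟨h1, h2, h3⟩, h⟩
          · exact Or.inl hp
          · have : p.2 ≠ b := fun h' => h (Prod.ext h1 h')
            exact Or.inr ⟨h1, h2, by omega⟩
      · rw [Set.union_sdiff_right, (hdisj a b).sdiff_eq_left]
        exact hc
      · rintro p (hp | hp)
        -- Columns to the right are untouched, and have at least `hi - lo` points, hence at least `b
        -- - a`.
        · have h1 : slice (V ∪ vseg x a b) p.1 = slice T p.1 := by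
            ext q
            constructor
            · rintro ⟨h1, h2⟩
              exact ⟨hWsub h1, h2⟩
            · rintro ⟨h1, h2⟩
              refine ⟨Or.inl ⟨h1, ?_⟩, h2⟩
              rw [h2]
              exact hp.2
          rw [h1]
          have := hcol p hp.1
          omega
        · rw [hp.1, hWx, ncard_vseg x (by omega)]
          omega
  have := main (hi - lo).toNat lo hi le_rfl le_rfl (by omega)
  rw [← hTeq] at this
  omega

theorem isConvexLattice_lt {T : Set (ℤ × ℤ)} (hT : IsConvexLattice T) (x : ℤ) :
    IsConvexLattice {p | p ∈ T ∧ x < p.1} := by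
  have : {p | p ∈ T ∧ x < p.1} = T ∩ {p | (-1) * p.1 + 0 * p.2 ≤ -x - 1} := by
    ext p
    simp only [Set.mem_ofPred_eq, Set.mem_inter_iff]
    constructor
    · rintro ⟨h1, h2⟩
      exact ⟨h1, by omega⟩
    · rintro ⟨h1, h2⟩
      exact ⟨h1, by omega⟩
  rw [this]
  exact hT.inter (isConvexLattice_halfPlane _ _ _)

/-- If the slices do not shrink by more than one point to the right, removing them from the left
shows that the discrepancy is positive. -/
theorem ncard_lt_complexity {η : ℤ × ℤ → A} (hne : IsVerticallyNonexpansive η)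
    (hb : ¬ HasVerticalBalanced η) (hper : ¬ Periodic η) {T : Set (ℤ × ℤ)} (hfin : T.Finite)
    (hconv : IsConvexLattice T)
    (hcol : ∀ p ∈ T, ∀ q ∈ T, p.1 ≤ q.1 → (slice T p.1).ncard ≤ (slice T q.1).ncard + 1) :
    T.ncard < complexity η T := by
  induction hn : T.ncard using Nat.strong_induction_on generalizing T with
  | _ n ih =>
  subst hn
  rcases T.eq_empty_or_nonempty with he | hnon
  · rw [he, Set.ncard_empty]
    exact one_le_complexity η Set.finite_empty
  obtain ⟨p₀, hp₀, hmin⟩ := Set.exists_min_image T Prod.fst hfin hnon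
  set x := p₀.1 with hx
  set V : Set (ℤ × ℤ) := {p | p ∈ T ∧ x < p.1} with hV
  have hTeq : T = V ∪ slice T x := by
    ext p
    constructor
    · intro hp
      rcases eq_or_lt_of_le (hmin p hp) with h | h
      · exact Or.inr ⟨hp, h.symm⟩
      · exact Or.inl ⟨hp, h⟩
    · rintro (hp | hp)
      · exact hp.1
      · exact hp.1
  have hdisj : Disjoint V (slice T x) := by
    rw [Set.disjoint_left]
    rintro p ⟨_, h1⟩ ⟨_, h2⟩
    omega
  have hVfin : V.Finite := hfin.subset fun p h => h.1
  have hsfin : (slice T x).Finite := hfin.subset (slice_subset T x)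
  have hcard : T.ncard = V.ncard + (slice T x).ncard := by
    conv_lhs => rw [hTeq]
    exact Set.ncard_union_eq hdisj hVfin hsfin
  have hsnon : (slice T x).Nonempty := ⟨p₀, hp₀, rfl⟩
  have hspos : 0 < (slice T x).ncard := (Set.ncard_pos hsfin).2 hsnon
  -- A single remaining column is beyond the column-removal lemma, as a balanced set must have
  -- positive area. There aperiodicity gives the bound.
  rcases V.eq_empty_or_nonempty with hVe | hVnon
  · obtain ⟨a, b, hab, hs⟩ := hconv.slice_eq_vseg hfin hsnon
    rw [hVe, Set.empty_union, hs] at hTeq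
    have h1 := ncard_vseg x (a := a) (b := b) (by omega)
    have h2 := lt_complexity_column hper (b - a + 1).toNat
    rw [hTeq, complexity_vseg]
    omega
  · have h1 := complexity_add_ncard_slice_le hne hb hfin hconv hmin
      (by obtain ⟨p, hp⟩ := hVnon; exact ⟨p, hp.1, hp.2⟩)
      (fun p hp => hcol p₀ hp₀ p hp (hmin p hp))
    have h2 := ih V.ncard (by omega) hVfin (isConvexLattice_lt hconv x) ?_ rfl
    · rw [← hV] at h1
      omega
    · intro p hp q hq hpq
      have e : ∀ p ∈ V, slice V p.1 = slice T p.1 := by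
        intro p hp
        ext q
        constructor
        · rintro ⟨h1, h2⟩
          exact ⟨h1.1, h2⟩
        · rintro ⟨h1, h2⟩
          exact ⟨⟨h1, by rw [h2]; exact hp.2⟩, h2⟩
      rw [e p hp, e q hq]
      exact hcol p hp.1 q hq.1 hpq

end Balanced

end Nivat

namespace Nivat

/-! ### Binary codes with many two-letter factors. -/

section Codes

/-- The letter `b'` follows the letter `b` in the word `c 0, ..., c 7`. -/
def Follows (c : ℕ → Bool) (b b' : Bool) : Prop := ∃ j < 7, c j = b ∧ c (j + 1) = b'

/-- At least three of the four two-letter words occur in `c 0, ..., c 7`. -/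
def IsRich (c : ℕ → Bool) : Prop :=
  (∃ b, Follows c b true ∧ Follows c b false) ∧ ∃ b, Follows c true b ∧ Follows c false b

theorem IsRich.exists_lt {c : ℕ → Bool} (h : IsRich c) (b : Bool) : ∃ j < 7, c j = b := by
  obtain ⟨-, b', ⟨j, hj, h1, -⟩, k, hk, h2, -⟩ := h
  cases b
  · exact ⟨k, hk, h2⟩
  · exact ⟨j, hj, h1⟩

variable {B : Type*}

/-- Both a value and the next value depend only on the current code letter. A letter followed by
both letters therefore forces the two values to coincide. The letter `c 7` also occurs earlier,
which settles the value at `8`. -/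
theorem IsRich.const_two {c : ℕ → Bool} (hc : IsRich c) {F : Bool → ℕ → B}
    (h0 : ∀ s j j', j ≤ 7 → j' ≤ 7 → c j = c j' → F s j = F s j')
    (h1 : ∀ s j j', j ≤ 7 → j' ≤ 7 → c j = c j' → F s (j + 1) = F s (j' + 1)) :
    ∀ s j, j ≤ 8 → F s j = F s 0 := by
  obtain ⟨⟨b, ⟨j₁, hj₁, h11, h12⟩, j₂, hj₂, h21, h22⟩, b', ⟨k₁, hk₁, h31, h32⟩,
    k₂, hk₂, h41, h42⟩ := hc
  have hrow : ∀ s j j', j ≤ 7 → j' ≤ 7 → F s j = F s j' := by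
    have key : ∀ s, F s (j₁ + 1) = F s (j₂ + 1) := fun s =>
      h1 s j₁ j₂ (by omega) (by omega) (h11.trans h21.symm)
    have hval : ∀ s j, j ≤ 7 → F s j = F s (j₁ + 1) := by
      intro s j hj
      cases hcj : c j
      · rw [key]
        exact h0 s j _ hj (by omega) (hcj.trans h22.symm)
      · exact h0 s j _ hj (by omega) (hcj.trans h12.symm)
    intro s j j' hj hj'
    rw [hval s j hj, hval s j' hj']
  intro s j hj
  rcases Nat.lt_or_ge j 8 with h | h
  · exact hrow s j 0 (by omega) (by omega)
  obtain rfl : j = 8 := by omega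
  have : ∃ k < 7, c k = c 7 := by
    cases c 7
    · exact ⟨k₂, hk₂, h41⟩
    · exact ⟨k₁, hk₁, h31⟩
  obtain ⟨k, hk, hck⟩ := this
  rw [← h1 s k 7 (by omega) le_rfl hck]
  exact hrow s _ _ (by omega) (by omega)

/-- Dependence of the second next value on the code reaches one index further. The predicate `P`
allows the conclusion for only some of the states. -/
theorem IsRich.const_three {c : ℕ → Bool} (hc : IsRich c) {F : Bool → ℕ → B}
    {P : Bool → Prop}
    (h0 : ∀ s, P s → ∀ j j', j ≤ 7 → j' ≤ 7 → c j = c j' → F s j = F s j')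
    (h1 : ∀ s, P s → ∀ j j', j ≤ 7 → j' ≤ 7 → c j = c j' → F s (j + 1) = F s (j' + 1))
    (h2 : ∀ s, P s → ∀ j j', j ≤ 7 → j' ≤ 7 → c j = c j' → F s (j + 2) = F s (j' + 2)) :
    ∀ s, P s → ∀ j, j ≤ 9 → F s j = F s 0 := by
  intro s hs
  have h8 : ∀ j, j ≤ 8 → F s j = F s 0 :=
    hc.const_two (F := fun _ => F s) (fun _ => h0 s hs)
      (fun _ => h1 s hs) true
  intro j hj
  rcases Nat.lt_or_ge j 9 with h | h
  · exact h8 j (by omega)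
  obtain rfl : j = 9 := by omega
  obtain ⟨k, hk, hck⟩ := hc.exists_lt (c 7)
  rw [← h2 s hs k 7 (by omega) le_rfl hck]
  exact h8 _ (by omega)

/-- Windows with letter `m` are constant, and those with the other letter all show one triple.
Richness provides either two consecutive windows of the second kind, or one followed by and one
preceded by a constant window. In both cases the overlaps make that triple constant too. -/
theorem IsRich.const_of_const_windows {c : ℕ → Bool} (hc : IsRich c) {s : ℕ → B} (m : Bool)
    (hm : ∀ j, j ≤ 7 → c j = m → s j = s (j + 1) ∧ s (j + 1) = s (j + 2))
    (hn : ∀ j j', j ≤ 7 → j' ≤ 7 → c j = !m → c j' = !m →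
      s j = s j' ∧ s (j + 1) = s (j' + 1) ∧ s (j + 2) = s (j' + 2)) :
    ∀ j, j ≤ 9 → s j = s 0 := by
  have hcases : (∃ j < 7, c j = !m ∧ c (j + 1) = !m) ∨
      ((∃ j < 7, c j = !m ∧ c (j + 1) = m) ∧ ∃ j < 7, c j = m ∧ c (j + 1) = !m) := by
    obtain ⟨⟨b, h1, h2⟩, b', h3, h4⟩ := hc
    unfold Follows at *
    cases m <;> cases b <;> cases b' <;> simp_all
  have hwin : ∀ j, j ≤ 7 → s j = s (j + 1) ∧ s (j + 1) = s (j + 2) := by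
    intro j hj
    by_cases hcj : c j = m
    · exact hm j hj hcj
    have hcj' : c j = !m := by
      revert hcj
      cases c j <;> cases m <;> simp
    rcases hcases with ⟨k, hk, hk1, hk2⟩ | ⟨⟨k, hk, hk1, hk2⟩, l, hl, hl1, hl2⟩
    · obtain ⟨a1, a2, a3⟩ := hn j k hj (by omega) hcj' hk1
      obtain ⟨b1, b2, b3⟩ := hn j (k + 1) hj (by omega) hcj' hk2
      exact ⟨b1.trans a2.symm, b2.trans a3.symm⟩
    · obtain ⟨a1, a2, a3⟩ := hn j k hj (by omega) hcj' hk1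
      obtain ⟨b1, b2, b3⟩ := hn j (l + 1) hj (by omega) hcj' hl2
      have c1 := (hm (k + 1) (by omega) hk2).1
      have c2 := (hm l (by omega) hl1).2
      exact ⟨b1.trans (c2.trans b2.symm), (a2.trans c1).trans a3.symm⟩
  intro j
  induction j with
  | zero => intro _; rfl
  | succ j ih =>
    intro hj
    rcases Nat.lt_or_ge j 8 with h | h
    · rw [← (hwin j (by omega)).1]
      exact ih (by omega)
    · obtain rfl : j = 8 := by omega
      rw [← (hwin 7 le_rfl).2]
      exact ih (by omega)

end Codes

/-! ### Coded pairs of configurations are impossible. -/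

section Trapezoid

/-- The trapezoid with three rows, cut off to the left of the column `l`. -/
def trapezoid (a t r l : ℤ) : Set (ℤ × ℤ) :=
  {p | l ≤ p.1 ∧ ((p.2 = 0 ∧ p.1 ≤ r + t) ∨ (p.2 = 1 ∧ p.1 ≤ r) ∨ (p.2 = 2 ∧ p.1 ≤ r - a))}

variable {A : Type*} {η : ℤ × ℤ → A} {a t r : ℤ} {c : ℕ → Bool} {σ : Bool → Bool}
  {pos : Bool → ℕ → ℤ × ℤ} {D : Bool → A}

/-- Two configurations that agree to the right of the column `0` and differ everywhere on it, such
that all ambiguous words of the truncated trapezoid occur along that column, as recorded by the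
code `c`. The states `s` distinguish the two configurations, up to the permutation `σ` of the
states from one row to the next. -/
structure CodedPair (η : ℤ × ℤ → A) (a t r : ℤ) (c : ℕ → Bool) (σ : Bool → Bool)
    (pos : Bool → ℕ → ℤ × ℤ) (D : Bool → A) : Prop where
  one_le : 1 ≤ t
  le_a : t ≤ a
  a_le : a ≤ r
  rich : IsRich c
  invol : ∀ s, σ (σ s) = s
  pos_succ : ∀ s j, pos (σ s) (j + 1) = pos s j + (0, 1)
  agree_iff : ∀ s s' j j', j ≤ 7 → j' ≤ 7 →
    (Agree η (trapezoid a t r 1) (pos s j) (pos s' j') ↔ c j = c j')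
  ambiguous : ∀ y y', Agree η (trapezoid a t r 1) y y' → ¬ Agree η (trapezoid a t r 0) y y' →
    ∃ j ≤ 7, Agree η (trapezoid a t r 1) y (pos true j)
  two_ext : ∀ y, ∀ j ≤ 7, Agree η (trapezoid a t r 1) y (pos true j) →
    ∃ s, Agree η (trapezoid a t r 0) y (pos s j)
  col_zero : ∀ s, ∀ j ≤ 9, η ((0, 0) + pos s j) = D s
  ne : D true ≠ D false
  tip : ∀ y y', Agree η (trapezoid a t r 0 \ {(r + t, 0)}) y y' →
    η ((r + t, 0) + y) = η ((r + t, 0) + y')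

theorem invol_fixed {σ : Bool → Bool} (h : ∀ s, σ (σ s) = s) {s₀ : Bool} (h₀ : σ s₀ = s₀)
    (s : Bool) : σ s = s := by
  by_cases hs : s = s₀
  · rw [hs, h₀]
  · by_contra hσ
    have h1 : σ s = s₀ := by
      revert hs hσ
      generalize σ s = u
      cases s <;> cases s₀ <;> cases u <;> simp
    have h2 := h s
    rw [h1, h₀] at h2
    exact hs h2.symm

namespace CodedPair

/-- Together with `row_two` this reduces all rows of a window to the row `0` of later positions, in
the state permuted by `σ`. -/
theorem row_one (h : CodedPair η a t r c σ pos D) (x : ℤ) (s : Bool) (j : ℕ) :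
    η ((x, 1) + pos s j) = η ((x, 0) + pos (σ s) (j + 1)) := by
  rw [h.pos_succ]
  congr 1
  ext <;> simp <;> ring

theorem row_two (h : CodedPair η a t r c σ pos D) (x : ℤ) (s : Bool) (j : ℕ) :
    η ((x, 2) + pos s j) = η ((x, 0) + pos s (j + 2)) := by
  have e : pos s (j + 2) = pos s j + (0, 2) := by
    have h1 := h.pos_succ (σ s) (j + 1)
    rw [h.invol] at h1
    rw [h1, h.pos_succ]
    ext <;> simp <;> ring
  rw [e]
  congr 1
  ext <;> simp <;> ring

/-- Columns up to `r` meet the window in the rows `0` and `1`, so a letter and its successor depend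
only on the code, and richness applies. The bound `8` comes from the row `1` of the window `7`. -/
theorem eq_of_mem (h : CodedPair η a t r c σ pos D) {x : ℤ} (hx : 1 ≤ x) (hxr : x ≤ r)
    (s s' : Bool) {j j' : ℕ} (hj : j ≤ 8) (hj' : j' ≤ 8) :
    η ((x, 0) + pos s j) = η ((x, 0) + pos s' j') := by
  have ht := h.one_le
  have m0 : (x, (0 : ℤ)) ∈ trapezoid a t r 1 := ⟨hx, Or.inl ⟨rfl, by simp only; omega⟩⟩
  have m1 : (x, (1 : ℤ)) ∈ trapezoid a t r 1 := ⟨hx, Or.inr (Or.inl ⟨rfl, hxr⟩)⟩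
  have h0 : ∀ s s' j j', j ≤ 7 → j' ≤ 7 → c j = c j' →
      η ((x, 0) + pos s j) = η ((x, 0) + pos s' j') := fun s s' j j' hj hj' hc =>
    (h.agree_iff s s' j j' hj hj').2 hc _ m0
  have h1 : ∀ s s' j j', j ≤ 7 → j' ≤ 7 → c j = c j' →
      η ((x, 0) + pos s (j + 1)) = η ((x, 0) + pos s' (j' + 1)) := by
    intro s s' j j' hj hj' hc
    have := (h.agree_iff (σ s) (σ s') j j' hj hj').2 hc _ m1
    rwa [h.row_one, h.row_one, h.invol, h.invol] at this
  have h2 := h.rich.const_two (F := fun s j => η ((x, 0) + pos s j)) (fun s => h0 s s)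
    (fun s => h1 s s)
  calc _ = η ((x, 0) + pos s 0) := h2 s j hj
    _ = η ((x, 0) + pos s' 0) := h0 s s' 0 0 (by omega) (by omega) rfl
    _ = _ := (h2 s' j' hj').symm

/-- Columns up to `r - a` also meet the row `2`, which gives access to the index `9`. -/
theorem eq_of_mem_top (h : CodedPair η a t r c σ pos D) {x : ℤ} (hx : 1 ≤ x) (hxr : x ≤ r - a)
    (s s' : Bool) {j j' : ℕ} (hj : j ≤ 9) (hj' : j' ≤ 9) :
    η ((x, 0) + pos s j) = η ((x, 0) + pos s' j') := by
  have ht := h.one_le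
  have hta := h.le_a
  have m2 : (x, (2 : ℤ)) ∈ trapezoid a t r 1 := ⟨hx, Or.inr (Or.inr ⟨rfl, hxr⟩)⟩
  have h9 : ∀ s j, j ≤ 9 → ∃ j' ≤ 8, η ((x, 0) + pos s j) = η ((x, 0) + pos s j') := by
    intro s j hj
    rcases Nat.lt_or_ge j 9 with hlt | hge
    · exact ⟨j, by omega, rfl⟩
    obtain rfl : j = 9 := by omega
    obtain ⟨k, hk, hck⟩ := h.rich.exists_lt (c 7)
    refine ⟨k + 2, by omega, ?_⟩
    have := (h.agree_iff s s k 7 (by omega) le_rfl).2 hck _ m2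
    rw [h.row_two, h.row_two] at this
    exact this.symm
  obtain ⟨k, hk, hk'⟩ := h9 s j hj
  obtain ⟨l, hl, hl'⟩ := h9 s' j' hj'
  rw [hk', hl']
  exact h.eq_of_mem hx (by omega) s s' hk hl

/-- The first column on which the two ambiguous words differ. -/
theorem exists_code_column (h : CodedPair η a t r c σ pos D) :
    ∃ e, r < e ∧ e ≤ r + t ∧
      (∀ s s' j j', j ≤ 7 → j' ≤ 7 → (η ((e, 0) + pos s j) = η ((e, 0) + pos s' j') ↔ c j = c j')) ∧
      ∀ x, 1 ≤ x → x < e → ∀ s s' j j', j ≤ 7 → j' ≤ 7 →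
        η ((x, 0) + pos s j) = η ((x, 0) + pos s' j') := by
  have ht := h.one_le
  obtain ⟨k, hk, hck⟩ := h.rich.exists_lt true
  obtain ⟨l, hl, hcl⟩ := h.rich.exists_lt false
  have hex : ∃ n : ℕ, 1 ≤ n ∧ (n : ℤ) ≤ t ∧
      η ((r + n, 0) + pos true k) ≠ η ((r + n, 0) + pos true l) := by
    -- If the lowest row showed no difference beyond `r`, windows with different code letters would
    -- agree everywhere.
    by_contra! hcon
    have : c k = c l := by
      refine (h.agree_iff true true k l (by omega) (by omega)).1 ?_
      rintro ⟨x, y⟩ ⟨hx, ⟨hy, hxr⟩ | ⟨hy, hxr⟩ | ⟨hy, hxr⟩⟩ <;> simp only at hx hy hxr <;> subst hy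
      · rcases le_or_gt x r with hle | hgt
        · exact h.eq_of_mem hx hle _ _ (by omega) (by omega)
        · have := hcon (x - r).toNat (by omega) (by omega)
          have e : r + ((x - r).toNat : ℤ) = x := by omega
          rwa [e] at this
      · rw [h.row_one, h.row_one]
        exact h.eq_of_mem hx hxr _ _ (by omega) (by omega)
      · rw [h.row_two, h.row_two]
        exact h.eq_of_mem_top hx hxr _ _ (by omega) (by omega)
    rw [hck, hcl] at this
    exact absurd this (by simp)
  classical
  obtain ⟨hn1, hnt, hne⟩ := Nat.find_spec hex
  have hmin := fun m => Nat.find_min hex (m := m)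
  set n := Nat.find hex with hn
  have mem : ∀ x : ℤ, 1 ≤ x → x ≤ r + t → (x, (0 : ℤ)) ∈ trapezoid a t r 1 := fun x h1 h2 =>
    ⟨h1, Or.inl ⟨rfl, h2⟩⟩
  have hr : 1 ≤ r := by
    have := h.le_a
    have := h.a_le
    omega
  have hcode : ∀ x : ℤ, 1 ≤ x → x ≤ r + t → ∀ s s' j j', j ≤ 7 → j' ≤ 7 → c j = c j' →
      η ((x, 0) + pos s j) = η ((x, 0) + pos s' j') := fun x h1 h2 s s' j j' hj hj' hc =>
    (h.agree_iff s s' j j' hj hj').2 hc _ (mem x h1 h2)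
  refine ⟨r + n, by omega, by omega, ?_, ?_⟩
  · intro s s' j j' hj hj'
    refine ⟨fun he => ?_, hcode _ (by omega) (by omega) s s' j j' hj hj'⟩
    by_contra hcc
    apply hne
    have hc1 := hcode (r + n) (by omega) (by omega)
    cases hcj : c j <;> cases hcj' : c j'
    · exact absurd (hcj.trans hcj'.symm) hcc
    · rw [hc1 true s' k j' (by omega) hj' (hck.trans hcj'.symm),
        hc1 true s l j (by omega) hj (hcl.trans hcj.symm)]
      exact he.symm
    · rw [hc1 true s k j (by omega) hj (hck.trans hcj.symm),
        hc1 true s' l j' (by omega) hj' (hcl.trans hcj'.symm)]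
      exact he
    · exact absurd (hcj.trans hcj'.symm) hcc
  · intro x hx1 hxe s s' j j' hj hj'
    rcases le_or_gt x r with hle | hgt
    · exact h.eq_of_mem hx1 hle _ _ (by omega) (by omega)
    have hkl : η ((x, 0) + pos true k) = η ((x, 0) + pos true l) := by
      have := hmin (x - r).toNat (by omega)
      by_contra hcon
      apply this
      have e : r + ((x - r).toNat : ℤ) = x := by omega
      rw [e]
      exact ⟨by omega, by omega, hcon⟩
    have hval : ∀ s j, j ≤ 7 → η ((x, 0) + pos s j) = η ((x, 0) + pos true k) := by
      intro s j hj
      have hc1 := hcode x hx1 (by omega)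
      cases hcj : c j
      · rw [hkl]
        exact hc1 _ _ _ _ hj (by omega) (hcj.trans hcl.symm)
      · exact hc1 _ _ _ _ hj (by omega) (hcj.trans hck.symm)
    rw [hval s j hj, hval s' j' hj']

/-- Constancy along each state spreads from the column `0` to the left, by as many columns as
separate `e` from the tip. After a shift by that distance the tip lies over the column `e`, where
the code is visible, while the rest of the window is blind to it. -/
theorem contradiction (h : CodedPair η a t r c σ pos D) : False := by
  obtain ⟨e, hre, het, hcode, hconst⟩ := h.exists_code_column
  have ht := h.one_le
  have hta := h.le_a
  have har := h.a_le
  have main : ∀ b : ℕ, (b : ℤ) ≤ r + t - e → ∀ x : ℤ, -b ≤ x → x ≤ 0 →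
      ∀ s j, j ≤ 9 → η ((x, 0) + pos s j) = η ((x, 0) + pos s 0) := by
    intro b
    induction b with
    | zero =>
      intro _ x hx hx0 s j hj
      obtain rfl : x = 0 := by push_cast at hx; omega
      rw [h.col_zero s j hj, h.col_zero s 0 (by omega)]
    | succ b ih =>
      intro hb x hx hx0
      push_cast at hb hx
      have ih' := ih (by omega)
      rcases eq_or_lt_of_le hx with hxb | hxb
      swap
      · exact ih' x (by omega) hx0
      set β : ℤ := b + 1 with hβ
      obtain rfl : x = -β := by omega
      have shift : ∀ (k y : ℤ) s j, η ((k, y) + (pos s j + (-β, 0))) = η ((k - β, y) + pos s j) := by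
        intro k y s j
        congr 1
        ext <;> simp <;> ring
      have ih9 : ∀ x : ℤ, -β < x → x ≤ 0 → ∀ s j j', j ≤ 9 → j' ≤ 9 →
          η ((x, 0) + pos s j) = η ((x, 0) + pos s j') := by
        intro x h1 h2 s j j' hj hj'
        rw [ih' x (by omega) h2 s j hj, ih' x (by omega) h2 s j' hj']
      -- In a window shifted left by `β`, columns up to `0` are constant by induction and the others
      -- lie in the unshifted truncated window. Hence its word still depends only on the state and
      -- the code letter.
      have window : ∀ s j j', j ≤ 7 → j' ≤ 7 → c j = c j' →
          Agree η (trapezoid a t r 1) (pos s j + (-β, 0)) (pos s j' + (-β, 0)) := by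
        intro s j j' hj hj' hc
        have hag := (h.agree_iff s s j j' hj hj').2 hc
        rintro ⟨k, y⟩ ⟨hk, hky⟩
        rw [shift, shift]
        simp only at hk hky
        rcases le_or_gt (k - β) 0 with hle | hgt
        · rcases hky with ⟨rfl, hkr⟩ | ⟨rfl, hkr⟩ | ⟨rfl, hkr⟩
          · exact ih9 _ (by omega) hle s j j' (by omega) (by omega)
          · rw [h.row_one, h.row_one]
            exact ih9 _ (by omega) hle _ _ _ (by omega) (by omega)
          · rw [h.row_two, h.row_two]
            exact ih9 _ (by omega) hle _ _ _ (by omega) (by omega)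
        · refine hag _ ⟨by simp only; omega, ?_⟩
          simp only
          omega
      -- the ambiguous windows
      set Amb : Bool → ℕ → Prop := fun s j =>
        ∃ k ≤ 7, Agree η (trapezoid a t r 1) (pos s j + (-β, 0)) (pos true k) with hAmb
      have amb_congr : ∀ s j j', j ≤ 7 → j' ≤ 7 → c j = c j' → Amb s j → Amb s j' := by
        rintro s j j' hj hj' hc ⟨k, hk, hag⟩
        exact ⟨k, hk, (window s j j' hj hj' hc).symm.trans hag⟩
      -- A word that is not ambiguous extends uniquely to the left, so its three letters on the
      -- column `-β` depend only on the code letter.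
      have notamb : ∀ s j j', j ≤ 7 → j' ≤ 7 → c j = c j' → ¬ Amb s j →
          η ((-β, 0) + pos s j) = η ((-β, 0) + pos s j') ∧
          η ((-β, 0) + pos (σ s) (j + 1)) = η ((-β, 0) + pos (σ s) (j' + 1)) ∧
          η ((-β, 0) + pos s (j + 2)) = η ((-β, 0) + pos s (j' + 2)) := by
        intro s j j' hj hj' hc hna
        have hS : Agree η (trapezoid a t r 0) (pos s j + (-β, 0)) (pos s j' + (-β, 0)) := by
          by_contra hcon
          exact hna (h.ambiguous _ _ (window s j j' hj hj' hc) hcon)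
        have g0 := hS (0, 0) ⟨le_rfl, Or.inl ⟨rfl, by simp only; omega⟩⟩
        have g1 := hS (0, 1) ⟨le_rfl, Or.inr (Or.inl ⟨rfl, by simp only; omega⟩)⟩
        have g2 := hS (0, 2) ⟨le_rfl, Or.inr (Or.inr ⟨rfl, by simp only; omega⟩)⟩
        rw [shift, shift, zero_sub] at g0 g1 g2
        rw [h.row_one, h.row_one] at g1
        rw [h.row_two, h.row_two] at g2
        exact ⟨g0, g1, g2⟩
      by_cases hA : ∃ s j, j ≤ 7 ∧ Amb s j
      swap
      · push Not at hA
        refine fun s => h.rich.const_three (F := fun s j => η ((-β, 0) + pos s j))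
          (P := fun _ => True) (fun s _ j j' hj hj' hc => (notamb s j j' hj hj' hc (hA s j hj)).1)
          (fun s _ j j' hj hj' hc => ?_)
          (fun s _ j j' hj hj' hc => (notamb s j j' hj hj' hc (hA s j hj)).2.2) s trivial
        have := (notamb (σ s) j j' hj hj' hc (hA _ j hj)).2.1
        rwa [h.invol] at this
      obtain ⟨s₀, j₀, hj₀, k₀, hk₀, hag₀⟩ := hA
      have hβr : β ≤ r := by omega
      -- Ambiguous words have equal letters in the rows `0` and `1` of the column `β`. Over that
      -- column the shifted window reads the column `0`, with letters `D s₀` and `D (σ s₀)`. So an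
      -- ambiguous shifted window excludes a swap.
      have hσ₀ : σ s₀ = s₀ := by
        have g0 := hag₀ (β, 0) ⟨by simp only; omega, Or.inl ⟨rfl, by simp only; omega⟩⟩
        have g1 := hag₀ (β, 1) ⟨by simp only; omega, Or.inr (Or.inl ⟨rfl, hβr⟩)⟩
        rw [shift, sub_self] at g0 g1
        rw [h.row_one, h.row_one] at g1
        rw [h.eq_of_mem (s' := true) (j' := k₀) (by omega) hβr _ (by omega) (by omega), ← g0,
          h.col_zero _ _ (by omega), h.col_zero _ _ (by omega)] at g1
        by_contra hcon
        have hne := h.ne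
        revert g1 hcon
        generalize σ s₀ = u
        cases s₀ <;> cases u <;> simp [hne, hne.symm]
      have hσ : ∀ s, σ s = s := by
        intro s
        by_contra hcon
        have h1 := h.invol s
        revert hσ₀ hcon h1
        exact fun a b c => b (invol_fixed h.invol a s)
      intro s
      by_cases hs : ∃ j, j ≤ 7 ∧ Amb s j
      swap
      · push Not at hs
        refine h.rich.const_three (F := fun s j => η ((-β, 0) + pos s j))
          (P := fun s' => s' = s) ?_ ?_ ?_ s rfl
        · rintro s' rfl j j' hj hj' hc
          exact (notamb s' j j' hj hj' hc (hs j hj)).1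
        · rintro s' rfl j j' hj hj' hc
          have := (notamb s' j j' hj hj' hc (hs j hj)).2.1
          rwa [hσ] at this
        · rintro s' rfl j j' hj hj' hc
          exact (notamb s' j j' hj hj' hc (hs j hj)).2.2
      obtain ⟨j₁, hj₁, k₁, hk₁, hag₁⟩ := hs
      -- For one state, only one code letter gives ambiguous windows. Over the column `e` a shifted
      -- window reads `e - β`, where the code is invisible, so two ambiguous windows show the same
      -- ambiguous word. But over `e + β`, still in the window, they read the column `e`, which
      -- separates the codes.
      have hnot : ∀ j, j ≤ 7 → c j ≠ c j₁ → ¬ Amb s j := by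
        rintro j hj hcj ⟨k, hk, hag⟩
        have m0 : ∀ x : ℤ, 1 ≤ x → x ≤ r + t → (x, (0 : ℤ)) ∈ trapezoid a t r 1 := fun x h1 h2 =>
          ⟨h1, Or.inl ⟨rfl, h2⟩⟩
        have g := hag (e, 0) (m0 e (by omega) het)
        have g₁ := hag₁ (e, 0) (m0 e (by omega) het)
        rw [shift] at g g₁
        rw [hconst (e - β) (by omega) (by omega) s s j j₁ hj hj₁, g₁] at g
        have hck := (hcode true true k₁ k hk₁ hk).1 g
        have hagk := (h.agree_iff true true k₁ k hk₁ hk).2 hck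
        have g' := ((hag₁.trans hagk).trans hag.symm) (e + β, 0) (m0 _ (by omega) (by omega))
        rw [shift, shift, add_sub_cancel_right] at g'
        exact hcj ((hcode s s j₁ j hj₁ hj).1 g').symm
      -- An ambiguous window has one of the two known extensions, whose column is constant since `σ`
      -- is the identity. The other windows share a common triple.
      refine h.rich.const_of_const_windows (s := fun j => η ((-β, 0) + pos s j)) (c j₁) ?_ ?_
      · intro j hj hcj
        obtain ⟨k, hk, hag⟩ := amb_congr s j₁ j hj₁ hj hcj.symm ⟨k₁, hk₁, hag₁⟩
        obtain ⟨s', hs'⟩ := h.two_ext _ k hk hag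
        have g0 := hs' (0, 0) ⟨le_rfl, Or.inl ⟨rfl, by simp only; omega⟩⟩
        have g1 := hs' (0, 1) ⟨le_rfl, Or.inr (Or.inl ⟨rfl, by simp only; omega⟩)⟩
        have g2 := hs' (0, 2) ⟨le_rfl, Or.inr (Or.inr ⟨rfl, by simp only; omega⟩)⟩
        rw [shift, zero_sub] at g0 g1 g2
        rw [h.row_one, h.row_one, hσ, hσ] at g1
        rw [h.row_two, h.row_two] at g2
        rw [h.col_zero _ _ (by omega)] at g0 g1 g2
        exact ⟨g0.trans g1.symm, g1.trans g2.symm⟩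
      · intro j j' hj hj' hcj hcj'
        have := notamb s j j' hj hj' (hcj.trans hcj'.symm)
          (hnot j hj (by rw [hcj]; cases c j₁ <;> simp))
        rwa [hσ] at this
  obtain ⟨k, hk, hck⟩ := h.rich.exists_lt true
  obtain ⟨l, hl, hcl⟩ := h.rich.exists_lt false
  have hB : (0 : ℤ) ≤ r + t - e := by omega
  set B : ℤ := r + t - e with hBdef
  have h9 : ∀ x : ℤ, -B ≤ x → x ≤ 0 → ∀ s j j', j ≤ 9 → j' ≤ 9 →
      η ((x, 0) + pos s j) = η ((x, 0) + pos s j') := by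
    intro x hx hx0 s j j' hj hj'
    have := main B.toNat (by omega) x (by omega) hx0 s
    rw [this j hj, this j' hj']
  have shift : ∀ (x y : ℤ) s j, η ((x, y) + (pos s j + (-B, 0))) = η ((x - B, y) + pos s j) := by
    intro k y s j
    congr 1
    ext <;> simp <;> ring
  -- Two windows with different code letters, shifted by `B`: every point except the tip reads a
  -- column before `e`, or a row where the letters are constant.
  have key : Agree η (trapezoid a t r 0 \ {(r + t, 0)}) (pos true k + (-B, 0))
      (pos true l + (-B, 0)) := by
    rintro ⟨x, y⟩ ⟨⟨hx, hxy⟩, hne⟩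
    rw [shift, shift]
    simp only at hx hxy
    rcases hxy with ⟨rfl, hxr⟩ | ⟨rfl, hxr⟩ | ⟨rfl, hxr⟩
    · have hlt : x ≠ r + t := fun h' => hne (by rw [h']; rfl)
      rcases le_or_gt (x - B) 0 with hle | hgt
      · exact h9 _ (by omega) hle _ _ _ (by omega) (by omega)
      · exact hconst _ (by omega) (by omega) _ _ _ _ (by omega) (by omega)
    · rw [h.row_one, h.row_one]
      rcases le_or_gt (x - B) 0 with hle | hgt
      · exact h9 _ (by omega) hle _ _ _ (by omega) (by omega)
      · exact h.eq_of_mem (by omega) (by omega) _ _ (by omega) (by omega)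
    · rw [h.row_two, h.row_two]
      rcases le_or_gt (x - B) 0 with hle | hgt
      · exact h9 _ (by omega) hle _ _ _ (by omega) (by omega)
      · exact h.eq_of_mem_top (by omega) (by omega) _ _ (by omega) (by omega)
  have := h.tip _ _ key
  rw [shift, shift] at this
  have e' : r + t - B = e := by omega
  rw [e'] at this
  have := (hcode true true k l (by omega) (by omega)).1 this
  rw [hck, hcl] at this
  exact absurd this (by simp)

end CodedPair

end Trapezoid

end Nivat

namespace Nivat

/-! ### Stacking eight trapezoids and counting codes. -/

section TallTrapezoid

/-- The union of the translates by `(0, 0), ..., (0, 7)` of a trapezoid. -/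
def tallTrapezoid (a t r l : ℤ) : Set (ℤ × ℤ) :=
  {p | l ≤ p.1 ∧ ((0 ≤ p.2 ∧ p.2 ≤ 7 ∧ p.1 ≤ r + t) ∨ (p.2 = 8 ∧ p.1 ≤ r) ∨
    (p.2 = 9 ∧ p.1 ≤ r - a))}

theorem trapezoid_finite (a t r l : ℤ) : (trapezoid a t r l).Finite := by
  refine ((Set.finite_Icc l (max (r + t) (max r (r - a)))).prod (Set.finite_Icc (0 : ℤ) 2)).subset ?_
  rintro ⟨x, y⟩ ⟨h1, h2⟩
  simp only at h1 h2
  refine ⟨⟨h1, ?_⟩, ?_, ?_⟩ <;> simp only <;> omega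

theorem tallTrapezoid_finite (a t r l : ℤ) : (tallTrapezoid a t r l).Finite := by
  refine ((Set.finite_Icc l (max (r + t) (max r (r - a)))).prod (Set.finite_Icc (0 : ℤ) 9)).subset ?_
  rintro ⟨x, y⟩ ⟨h1, h2⟩
  simp only at h1 h2
  refine ⟨⟨h1, ?_⟩, ?_, ?_⟩ <;> simp only <;> omega

theorem forall_of_two_consecutive {E : ℕ → Prop} {n y : ℕ} (hy : y ≤ n + 1)
    (hup : ∀ j ≤ n, E j → E (j + 1) → E (j + 2))
    (hdown : ∀ j ≤ n, E (j + 1) → E (j + 2) → E j) (h0 : E y) (h1 : E (y + 1)) :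
    ∀ j ≤ n + 2, E j := by
  have h : ∀ k, y + k ≤ n + 1 → E (y + k) ∧ E (y + k + 1) := by
    intro k
    induction k with
    | zero => exact fun _ => ⟨h0, h1⟩
    | succ k ih =>
      intro hk
      obtain ⟨a, b⟩ := ih (by omega)
      exact ⟨b, hup (y + k) (by omega) a b⟩
  have h' : ∀ k, k ≤ y → E (y - k) ∧ E (y - k + 1) := by
    intro k
    induction k with
    | zero => exact fun _ => ⟨h0, h1⟩
    | succ k ih =>
      intro hk
      obtain ⟨a, b⟩ := ih (by omega)
      have e : y - k = y - (k + 1) + 1 := by omega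
      rw [e] at a b
      exact ⟨hdown _ (by omega) a b, a⟩
  intro j hj
  rcases Nat.lt_or_ge j y with hlt | hge
  · have := (h' (y - j) (by omega)).1
    rwa [show y - (y - j) = j by omega] at this
  · rcases Nat.lt_or_ge j (n + 2) with h2 | h2
    · have := (h (j - y) (by omega)).1
      rwa [show y + (j - y) = j by omega] at this
    · have := (h (j - 1 - y) (by omega)).2
      rwa [show y + (j - 1 - y) + 1 = j by omega] at this

variable {A : Type*} {η : ℤ × ℤ → A} {a t r : ℤ}

theorem apply_add_window (η : ℤ × ℤ → A) (x y : ℤ) (z : ℤ × ℤ) (j : ℕ) :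
    η ((x, y) + (z + (0, (j : ℤ)))) = η ((x, y + j) + z) := by
  congr 1
  ext <;> simp
  ring

theorem agree_window (ht : 0 ≤ t) (ha : 0 ≤ a) {z z' : ℤ × ℤ}
    (h : Agree η (tallTrapezoid a t r 1) z z') {j : ℕ} (hj : j ≤ 7) :
    Agree η (trapezoid a t r 1) (z + (0, (j : ℤ))) (z' + (0, (j : ℤ))) := by
  rintro ⟨x, y⟩ ⟨h1, h2⟩
  simp only at h1 h2
  rw [apply_add_window η, apply_add_window η]
  refine h _ ⟨h1, ?_⟩
  simp only
  omega

theorem agree_tallTrapezoid {z z' : ℤ × ℤ}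
    (h : ∀ j : ℕ, j ≤ 7 →
      Agree η (trapezoid a t r 1) (z + (0, (j : ℤ))) (z' + (0, (j : ℤ)))) :
    Agree η (tallTrapezoid a t r 1) z z' := by
  rintro ⟨x, y⟩ ⟨h1, h2⟩
  simp only at h1 h2
  have key : ∀ (j : ℕ) (i : ℤ), j ≤ 7 → (x, i) ∈ trapezoid a t r 1 → y = i + j →
      η ((x, y) + z) = η ((x, y) + z') := by
    intro j i hj hi hy
    have := h j hj _ hi
    rwa [apply_add_window η, apply_add_window η, ← hy] at this
  rcases h2 with ⟨hy, hy', hx⟩ | ⟨hy, hx⟩ | ⟨hy, hx⟩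
  · exact key y.toNat 0 (by omega) ⟨h1, Or.inl ⟨rfl, hx⟩⟩ (by omega)
  · exact key 7 1 (by omega) ⟨h1, Or.inr (Or.inl ⟨rfl, hx⟩)⟩ (by simp [hy])
  · exact key 7 2 (by omega) ⟨h1, Or.inr (Or.inr ⟨rfl, hx⟩)⟩ (by simp [hy])

/-- The two generated vertices propagate equality along the left column: two consecutive equal
letters determine the next letter up through `(0, 2)` and the next letter down through `(0, 0)`. -/
theorem eq_on_column (ht : 0 ≤ t) (ha : 0 ≤ a)
    (hg0 : Generates η (trapezoid a t r 0) (0, 0)) (hg2 : Generates η (trapezoid a t r 0) (0, 2))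
    {z z' : ℤ × ℤ} (h : Agree η (tallTrapezoid a t r 1) z z') {y : ℕ} (hy : y ≤ 8)
    (h0 : η ((0, (y : ℤ)) + z) = η ((0, (y : ℤ)) + z'))
    (h1 : η ((0, (y : ℤ) + 1) + z) = η ((0, (y : ℤ) + 1) + z')) :
    ∀ j : ℕ, j ≤ 9 → η ((0, (j : ℤ)) + z) = η ((0, (j : ℤ)) + z') := by
  refine forall_of_two_consecutive (E := fun j : ℕ => η ((0, (j : ℤ)) + z) = η ((0, (j : ℤ)) + z'))
    (n := 7) hy ?_ ?_ h0 (by push_cast; exact h1)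
  · intro j hj e0 e1
    have := hg2 (z + (0, (j : ℤ))) (z' + (0, (j : ℤ))) ?_
    · rw [apply_add_window η, apply_add_window η] at this
      push_cast
      rwa [add_comm (j : ℤ) 2]
    · rintro ⟨x, y⟩ ⟨⟨h1, h2⟩, hne⟩
      rcases eq_or_lt_of_le h1 with rfl | h1
      · have : y ≠ 2 := fun h => hne (by rw [h]; rfl)
        rw [apply_add_window η, apply_add_window η]
        rcases h2 with ⟨rfl, -⟩ | ⟨rfl, -⟩ | ⟨rfl, -⟩
        · rwa [zero_add]
        · push_cast at e1
          rwa [add_comm 1 (j : ℤ)]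
        · exact absurd rfl this
      · exact agree_window ht ha h hj _ ⟨h1, h2⟩
  · intro j hj e1 e2
    have := hg0 (z + (0, (j : ℤ))) (z' + (0, (j : ℤ))) ?_
    · rw [apply_add_window η, apply_add_window η, zero_add] at this
      exact this
    · rintro ⟨x, y⟩ ⟨⟨h1, h2⟩, hne⟩
      rcases eq_or_lt_of_le h1 with rfl | h1
      · have : y ≠ 0 := fun h => hne (by rw [h]; rfl)
        rw [apply_add_window η, apply_add_window η]
        push_cast at e1 e2
        rcases h2 with ⟨rfl, -⟩ | ⟨rfl, -⟩ | ⟨rfl, -⟩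
        · exact absurd rfl this
        · rwa [add_comm 1 (j : ℤ)]
        · rwa [add_comm 2 (j : ℤ)]
      · exact agree_window ht ha h hj _ ⟨h1, h2⟩

theorem exceptional_or {V S : Set (ℤ × ℤ)} {y y' : ℤ × ℤ} (h : Agree η V y y')
    (h' : ¬ Agree η S y y') : IsExceptional η V S y ∨ IsExceptional η V S y' := by
  by_contra! hc
  obtain ⟨h1, h2⟩ := hc
  unfold IsExceptional at h1 h2
  rw [not_not] at h1 h2
  rw [← canonical_eq h] at h2
  exact h' (h1.symm.trans h2)

/-- The tall trapezoid together with nine points in the column to its left. -/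
def extendedTrapezoid (a t r : ℤ) : Set (ℤ × ℤ) := tallTrapezoid a t r 1 ∪ vseg 0 0 8

theorem extendedTrapezoid_finite (a t r : ℤ) : (extendedTrapezoid a t r).Finite :=
  (tallTrapezoid_finite a t r 1).union (vseg_finite 0 0 8)

theorem agree_extendedTrapezoid {z z' : ℤ × ℤ} (h : Agree η (tallTrapezoid a t r 1) z z')
    (h' : ∀ j : ℕ, j ≤ 9 → η ((0, (j : ℤ)) + z) = η ((0, (j : ℤ)) + z')) :
    Agree η (extendedTrapezoid a t r) z z' := by
  rintro ⟨x, y⟩ (hp | ⟨hx, h1, h2⟩)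
  · exact h _ hp
  · simp only at hx h1 h2
    subst hx
    have := h' y.toNat (by omega)
    rwa [show ((y.toNat : ℕ) : ℤ) = y by omega] at this

/-- The codes that are not rich are the two constant ones, the two alternating ones, and the four in
which only the first or only the last letter deviates. -/
theorem card_not_isRich :
    {k : Fin 8 → Bool | ¬ IsRich fun j => if h : j < 8 then k ⟨j, h⟩ else false}.ncard ≤ 8 := by
  classical
  have hd : ∀ k : Fin 8 → Bool, (IsRich fun j => if h : j < 8 then k ⟨j, h⟩ else false) ↔
      ((∃ b : Bool, (∃ j : Fin 7, k j.castSucc = b ∧ k j.succ = true) ∧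
        ∃ j : Fin 7, k j.castSucc = b ∧ k j.succ = false) ∧
      ∃ b : Bool, (∃ j : Fin 7, k j.castSucc = true ∧ k j.succ = b) ∧
        ∃ j : Fin 7, k j.castSucc = false ∧ k j.succ = b) := by
    intro k
    have : ∀ b b' : Bool, Follows (fun j => if h : j < 8 then k ⟨j, h⟩ else false) b b' ↔
        ∃ j : Fin 7, k j.castSucc = b ∧ k j.succ = b' := by
      intro b b'
      constructor
      · rintro ⟨j, hj, h1, h2⟩
        refine ⟨⟨j, hj⟩, ?_, ?_⟩
        · exact (dif_pos (show j < 8 by omega)).symm.trans h1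
        · exact (dif_pos (show j + 1 < 8 by omega)).symm.trans h2
      · rintro ⟨⟨j, hj⟩, h1, h2⟩
        refine ⟨j, hj, ?_, ?_⟩
        · exact (dif_pos (show j < 8 by omega)).trans h1
        · exact (dif_pos (show j + 1 < 8 by omega)).trans h2
    simp only [IsRich, this]
  simp only [hd]
  rw [Set.ncard_eq_toFinset_card', Set.toFinset_ofPred]
  decide +kernel

/-- Two configurations that agree on the tall trapezoid and differ on each two consecutive points
of the column to its left. -/
structure DifferOnColumn (η : ℤ × ℤ → A) (a t r : ℤ) (z z' : ℤ × ℤ) : Prop where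
  agree : Agree η (tallTrapezoid a t r 1) z z'
  differ : ∀ j : ℕ, j ≤ 8 → η ((0, (j : ℤ)) + z) = η ((0, (j : ℤ)) + z') →
    η ((0, (j : ℤ) + 1) + z) ≠ η ((0, (j : ℤ) + 1) + z')

theorem DifferOnColumn.symm {z z' : ℤ × ℤ} (h : DifferOnColumn η a t r z z') :
    DifferOnColumn η a t r z' z :=
  ⟨h.agree.symm, fun j hj h1 h2 => h.differ j hj h1.symm h2.symm⟩

theorem DifferOnColumn.not_agree {z z' : ℤ × ℤ} (h : DifferOnColumn η a t r z z')
    (ht : 0 ≤ t) (hr : 0 ≤ r) {j : ℕ} (hj : j ≤ 8) :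
    ¬ Agree η (trapezoid a t r 0) (z + (0, (j : ℤ))) (z' + (0, (j : ℤ))) := by
  intro hag
  have h0 := hag (0, 0) ⟨le_rfl, Or.inl ⟨rfl, by simp only; omega⟩⟩
  have h1 := hag (0, 1) ⟨le_rfl, Or.inr (Or.inl ⟨rfl, hr⟩)⟩
  rw [apply_add_window η, apply_add_window η] at h0 h1
  rw [zero_add] at h0
  rw [add_comm 1 (j : ℤ)] at h1
  exact h.differ j hj h0 h1

theorem IsExceptional.differOnColumn (ht : 0 ≤ t) (ha : 0 ≤ a)
    (hg0 : Generates η (trapezoid a t r 0) (0, 0)) (hg2 : Generates η (trapezoid a t r 0) (0, 2))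
    {z : ℤ × ℤ} (hz : IsExceptional η (tallTrapezoid a t r 1) (extendedTrapezoid a t r) z) :
    DifferOnColumn η a t r (canonical η (tallTrapezoid a t r 1) z) z :=
  ⟨agree_canonical η _ z, fun _ hj h0 h1 => hz (agree_extendedTrapezoid (agree_canonical η _ z)
    (eq_on_column ht ha hg0 hg2 (agree_canonical η _ z) hj h0 h1))⟩

theorem agree_extendedTrapezoid_of_agree (ht : 0 ≤ t) (hr : 0 ≤ r) (ha : 0 ≤ a)
    (hg0 : Generates η (trapezoid a t r 0) (0, 0)) (hg2 : Generates η (trapezoid a t r 0) (0, 2))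
    {z z' : ℤ × ℤ} (h : Agree η (tallTrapezoid a t r 1) z z')
    (hS : Agree η (trapezoid a t r 0) z z') : Agree η (extendedTrapezoid a t r) z z' := by
  refine agree_extendedTrapezoid h (eq_on_column ht ha hg0 hg2 h (y := 0) (by omega) ?_ ?_)
  · exact hS (0, 0) ⟨le_rfl, Or.inl ⟨rfl, by simp only; omega⟩⟩
  · exact hS (0, 1) ⟨le_rfl, Or.inr (Or.inl ⟨rfl, hr⟩)⟩

theorem trapezoid_subset (a t r : ℤ) : trapezoid a t r 1 ⊆ trapezoid a t r 0 :=
  fun _ h => ⟨zero_le_one.trans h.1, h.2⟩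

/-- The words of the truncated trapezoid that extend in several ways: there are exactly two of
them, and each has exactly two extensions. -/
structure TwoAmbiguous (η : ℤ × ℤ → A) (V S : Set (ℤ × ℤ)) (ν₁ ν₂ : ℤ × ℤ) : Prop where
  ne : ¬ Agree η V ν₁ ν₂
  or_of_not_agree : ∀ y y', Agree η V y y' → ¬ Agree η S y y' → Agree η V y ν₁ ∨ Agree η V y ν₂
  two_ext : ∀ y y' y'', Agree η V y y' → ¬ Agree η S y y' → Agree η V y'' y →
    Agree η S y'' y ∨ Agree η S y'' y'

/-- With at most two exceptional words, over different `V`-words, each ambiguous `V`-word has just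
its chosen extension and one exceptional extension. -/
theorem twoAmbiguous_of_isExceptional [Finite A] {V S : Set (ℤ × ℤ)} (hVS : V ⊆ S) (hS : S.Finite)
    (h2 : complexity η S ≤ complexity η V + 2) {ν₁ ν₂ : ℤ × ℤ} (h₁ : IsExceptional η V S ν₁)
    (h₂ : IsExceptional η V S ν₂) (hne : ¬ Agree η V ν₁ ν₂) : TwoAmbiguous η V S ν₁ ν₂ := by
  have hne' : ¬ Agree η S ν₁ ν₂ := fun h => hne (h.mono hVS)
  have hexc : ∀ ν, IsExceptional η V S ν → Agree η S ν ν₁ ∨ Agree η S ν ν₂ := by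
    intro ν hν
    obtain ⟨i, j, hij, h⟩ := exists_agree_of_lt hVS hS h2 (by norm_num : 2 < 3) ![ν, ν₁, ν₂]
      (by intro i; fin_cases i <;> assumption)
    fin_cases i <;> fin_cases j <;> first | exact absurd hij (by decide) | skip
    · exact Or.inl h
    · exact Or.inr h
    · exact absurd h hne'
  have hcan : ∀ y, ¬ IsExceptional η V S y → Agree η S (canonical η V y) y := fun y h =>
    not_not.1 h
  have hsame : ∀ y y', IsExceptional η V S y → IsExceptional η V S y' → Agree η V y y' →
      Agree η S y y' := by
    intro y y' hy hy' hag
    rcases hexc y hy with h | h <;> rcases hexc y' hy' with h' | h'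
    · exact h.trans h'.symm
    · exact absurd (((h.symm.mono hVS).trans hag).trans (h'.mono hVS)) hne
    · exact absurd (((h'.symm.mono hVS).trans hag.symm).trans (h.mono hVS)) hne
    · exact h.trans h'.symm
  have hsame' : ∀ y y', ¬ IsExceptional η V S y → ¬ IsExceptional η V S y' → Agree η V y y' →
      Agree η S y y' := by
    intro y y' hy hy' hag
    have := hcan y hy
    rw [canonical_eq hag] at this
    exact this.symm.trans (hcan y' hy')
  refine ⟨hne, ?_, ?_⟩
  · intro y y' hag hnot
    rcases exceptional_or hag hnot with h | h
    · exact (hexc y h).imp (fun h => h.mono hVS) fun h => h.mono hVS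
    · exact (hexc y' h).imp (fun h => hag.trans (h.mono hVS)) fun h => hag.trans (h.mono hVS)
  · intro y y' y'' hag hnot hag'
    by_cases hy : IsExceptional η V S y <;> by_cases hy' : IsExceptional η V S y' <;>
      by_cases hy'' : IsExceptional η V S y''
    · exact Or.inl (hsame _ _ hy'' hy hag')
    · exact absurd (hsame _ _ hy hy' hag) hnot
    · exact Or.inl (hsame _ _ hy'' hy hag')
    · exact Or.inr (hsame' _ _ hy'' hy' (hag'.trans hag))
    · exact Or.inr (hsame _ _ hy'' hy' (hag'.trans hag))
    · exact Or.inl (hsame' _ _ hy'' hy hag')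
    · exact absurd (hsame' _ _ hy hy' hag) hnot
    · exact absurd (hsame' _ _ hy hy' hag) hnot

/-- The positions at which one of the two ambiguous words is seen on a vertical line. -/
noncomputable def code (η : ℤ × ℤ → A) (V : Set (ℤ × ℤ)) (ν z : ℤ × ℤ) (j : ℕ) : Bool :=
  open Classical in decide (Agree η V (z + (0, (j : ℤ))) ν)

theorem code_eq_true_iff {V : Set (ℤ × ℤ)} {ν z : ℤ × ℤ} {j : ℕ} :
    code η V ν z j = true ↔ Agree η V (z + (0, (j : ℤ))) ν := by
  classical
  exact decide_eq_true_iff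

theorem agree_iff_code_eq {V : Set (ℤ × ℤ)} {ν₁ ν₂ z z' : ℤ × ℤ} {j j' : ℕ}
    (hne : ¬ Agree η V ν₁ ν₂)
    (h : Agree η V (z + (0, (j : ℤ))) ν₁ ∨ Agree η V (z + (0, (j : ℤ))) ν₂)
    (h' : Agree η V (z' + (0, (j' : ℤ))) ν₁ ∨ Agree η V (z' + (0, (j' : ℤ))) ν₂) :
    Agree η V (z + (0, (j : ℤ))) (z' + (0, (j' : ℤ))) ↔ code η V ν₁ z j = code η V ν₁ z' j' := by
  unfold code
  rw [decide_eq_decide]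
  constructor
  · intro hag
    exact ⟨fun h => hag.symm.trans h, fun h => hag.trans h⟩
  · intro hiff
    rcases h with h | h
    · exact h.trans (hiff.1 h).symm
    rcases h' with h' | h'
    · exact absurd ((hiff.2 h').symm.trans h) hne
    · exact h.trans h'.symm

/-- Every exceptional word of the extended trapezoid comes with a partner that differs from it in
all eight windows, so each window shows an ambiguous word. The resulting code determines the
exceptional word. There are at least nine of these and at most eight codes that are not rich. -/
theorem exists_rich_code [Finite A] (ht : 0 ≤ t) (hr : 0 ≤ r) (ha : 0 ≤ a)
    (hg0 : Generates η (trapezoid a t r 0) (0, 0)) (hg2 : Generates η (trapezoid a t r 0) (0, 2))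
    (h2 : complexity η (trapezoid a t r 0) ≤ complexity η (trapezoid a t r 1) + 2)
    (h9 : complexity η (tallTrapezoid a t r 1) + 9 ≤ complexity η (extendedTrapezoid a t r)) :
    ∃ ν₁ ν₂ z z', TwoAmbiguous η (trapezoid a t r 1) (trapezoid a t r 0) ν₁ ν₂ ∧
      DifferOnColumn η a t r z z' ∧ IsRich (code η (trapezoid a t r 1) ν₁ z) := by
  set V := trapezoid a t r 1 with hV
  set S := trapezoid a t r 0 with hS
  set V' := tallTrapezoid a t r 1 with hV'
  set S' := extendedTrapezoid a t r with hS'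
  have hVS : V ⊆ S := trapezoid_subset a t r
  have hSfin : S.Finite := trapezoid_finite a t r 0
  have hVS' : V' ⊆ S' := Set.subset_union_left
  have hSfin' : S'.Finite := extendedTrapezoid_finite a t r
  have hdiff : ∀ z, IsExceptional η V' S' z → DifferOnColumn η a t r (canonical η V' z) z :=
    fun z hz => hz.differOnColumn ht ha hg0 hg2
  have hexc : ∀ z, IsExceptional η V' S' z → ∀ j : ℕ, j ≤ 7 → ∃ ν, IsExceptional η V S ν ∧
      Agree η V (z + (0, (j : ℤ))) ν := by
    intro z hz j hj
    have hw := agree_window ht ha (hdiff z hz).agree hj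
    rcases exceptional_or hw ((hdiff z hz).not_agree ht hr (by omega)) with h | h
    · exact ⟨_, h, hw.symm⟩
    · exact ⟨_, h, Agree.refl η _ _⟩
  have hzero : ∀ z : ℤ × ℤ, z + (0, ((0 : ℕ) : ℤ)) = z := fun z => by ext <;> simp
  have hsecond : ∀ z z', IsExceptional η V' S' z → IsExceptional η V' S' z' → Agree η V' z z' →
      Agree η S z z' → Agree η S' z z' := fun z z' _ _ hag hag' =>
    agree_extendedTrapezoid_of_agree ht hr ha hg0 hg2 hag hag'
  obtain ⟨ν₁, ν₂, hν₁, hν₂, hne⟩ : ∃ ν₁ ν₂, IsExceptional η V S ν₁ ∧ IsExceptional η V S ν₂ ∧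
      ¬ Agree η V ν₁ ν₂ := by
    by_contra! hcon
    obtain ⟨z₀, hz₀⟩ : ∃ z, IsExceptional η V' S' z := by
      by_contra! hno
      have := complexity_le_add_of_labels hVS' hSfin' (fun _ => ()) (C := ∅)
        (fun z hz => absurd hz (hno z)) fun z _ hz => absurd hz (hno z)
      rw [Set.ncard_empty] at this
      omega
    obtain ⟨ν₀, hν₀, -⟩ := hexc z₀ hz₀ 0 (by omega)
    have hall : ∀ z, IsExceptional η V' S' z → ∀ j : ℕ, j ≤ 7 →
        Agree η V (z + (0, (j : ℤ))) ν₀ := by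
      intro z hz j hj
      obtain ⟨ν, hν, h⟩ := hexc z hz j hj
      exact h.trans (hcon ν ν₀ hν hν₀)
    have hSf := hSfin.to_subtype
    -- If only one truncated word were ambiguous, all windows would show it, and the first `S`-word
    -- would determine everything. It has at most three values: at most two exceptional ones and the
    -- chosen extension.
    have hlab := complexity_le_add_of_labels (η := η) hVS' hSfin' (wordAt η S)
      (C := insert (wordAt η S (canonical η V ν₀)) (exceptional η V S)) ?_ ?_
    · have h3 := Set.ncard_insert_le (wordAt η S (canonical η V ν₀)) (exceptional η V S)
      have h4 := complexity_eq_add η hVS hSfin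
      omega
    · intro z hz
      by_cases hexz : IsExceptional η V S z
      · exact Set.mem_insert_of_mem _ ⟨z, hexz, rfl⟩
      · have hag := hall z hz 0 (by omega)
        rw [hzero] at hag
        left
        rw [wordAt_eq_iff, ← canonical_eq hag]
        exact (not_not.1 hexz).symm
    · intro z z' hz hz' hK
      exact hsecond z z' hz hz' (agree_tallTrapezoid fun j hj =>
        (hall z hz j hj).trans (hall z' hz' j hj).symm) (wordAt_eq_iff.1 hK)
  have htwo := twoAmbiguous_of_isExceptional hVS hSfin h2 hν₁ hν₂ hne
  have hor : ∀ z, IsExceptional η V' S' z → ∀ j : ℕ, j ≤ 7 →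
      Agree η V (z + (0, (j : ℤ))) ν₁ ∨ Agree η V (z + (0, (j : ℤ))) ν₂ := fun z hz j hj =>
    htwo.or_of_not_agree _ _ (agree_window ht ha (hdiff z hz).symm.agree hj)
      ((hdiff z hz).symm.not_agree ht hr (by omega))
  by_contra! hcon
  have hlab := complexity_le_add_of_labels (η := η) hVS' hSfin'
    (κ := Fin 8 → Bool) (fun z i => code η V ν₁ z i)
    (C := {k : Fin 8 → Bool | ¬ IsRich fun j => if h : j < 8 then k ⟨j, h⟩ else false}) ?_ ?_
  · have := card_not_isRich
    omega
  · intro z hz hrich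
    refine hcon ν₁ ν₂ z _ htwo (hdiff z hz).symm ?_
    have hF : ∀ b b', Follows (fun j => if h : j < 8 then code η V ν₁ z ((⟨j, h⟩ : Fin 8) : ℕ)
        else false) b b' → Follows (code η V ν₁ z) b b' := by
      rintro b b' ⟨j, hj, h1, h2⟩
      exact ⟨j, hj, (dif_pos (show j < 8 by omega)).symm.trans h1,
        (dif_pos (show j + 1 < 8 by omega)).symm.trans h2⟩
    obtain ⟨⟨b, h1, h2⟩, b', h3, h4⟩ := hrich
    exact ⟨⟨b, hF _ _ h1, hF _ _ h2⟩, b', hF _ _ h3, hF _ _ h4⟩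
  · intro z z' hz hz' hK
    have hag : Agree η V' z z' := agree_tallTrapezoid fun j hj =>
      (agree_iff_code_eq hne (hor z hz j hj) (hor z' hz' j hj)).2
        (congrFun hK ⟨j, by omega⟩)
    have hz0 : ∀ {y y'}, DifferOnColumn η a t r y y' → ¬ Agree η S y y' := by
      intro y y' h
      have := h.not_agree ht hr (j := 0) (by omega)
      rwa [hzero, hzero] at this
    have hw0 : ∀ {y y'}, Agree η V' y y' → Agree η V y y' := by
      intro y y' h
      have := agree_window ht ha h (j := 0) (by omega)
      rwa [hzero, hzero] at this
    refine hsecond z z' hz hz' hag ?_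
    -- Equal codes give equal words on the tall trapezoid, hence the same chosen position. Both
    -- words differ from its extension in the lowest window, and only one alternative remains there.
    rcases htwo.two_ext z (canonical η V' z) z' (hw0 (hdiff z hz).symm.agree)
      (hz0 (hdiff z hz).symm) (hw0 hag.symm) with h | h
    · exact h.symm
    · rw [canonical_eq hag] at h
      exact absurd h (hz0 (hdiff z' hz').symm)

/-- A trapezoid whose leftmost column has three points, only two ambiguous words and three
generated vertices cannot be extended by a column of nine points in the generic way. -/
theorem complexity_extendedTrapezoid_lt [Finite A] (ht : 1 ≤ t) (hta : t ≤ a) (har : a ≤ r)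
    (hg0 : Generates η (trapezoid a t r 0) (0, 0)) (hg2 : Generates η (trapezoid a t r 0) (0, 2))
    (hgt : Generates η (trapezoid a t r 0) (r + t, 0))
    (h2 : complexity η (trapezoid a t r 0) ≤ complexity η (trapezoid a t r 1) + 2) :
    complexity η (extendedTrapezoid a t r) < complexity η (tallTrapezoid a t r 1) + 9 := by
  by_contra! h9
  obtain ⟨ν₁, ν₂, z, z', htwo, hdiff, hrich⟩ := exists_rich_code (by omega) (by omega) (by omega)
    hg0 hg2 h2 h9
  set V := trapezoid a t r 1 with hV
  set S := trapezoid a t r 0 with hS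
  set c := code η V ν₁ z with hc
  set base : Bool → ℤ × ℤ := fun s => cond s z z' with hbase
  set h : Bool → ℕ → A := fun s j => η ((0, (j : ℤ)) + base s) with hh
  have hd : ∀ s, DifferOnColumn η a t r (base s) (base !s) := by
    intro s
    cases s
    · exact hdiff.symm
    · exact hdiff
  have hW : ∀ s s' (j : ℕ), j ≤ 7 → Agree η V (base s + (0, (j : ℤ))) (base s' + (0, (j : ℤ))) := by
    intro s s' j hj
    by_cases hs : s' = s
    · rw [hs]
      exact Agree.refl η _ _
    · obtain rfl : s' = !s := by revert hs; cases s <;> cases s' <;> simp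
      exact agree_window (by omega) (by omega) (hd s).agree hj
  have hnot : ∀ s (j : ℕ), j ≤ 7 →
      ¬ Agree η S (base s + (0, (j : ℤ))) (base (!s) + (0, (j : ℤ))) := fun s j hj =>
    (hd s).not_agree (by omega) (by omega) (by omega)
  have hor : ∀ s (j : ℕ), j ≤ 7 →
      Agree η V (base s + (0, (j : ℤ))) ν₁ ∨ Agree η V (base s + (0, (j : ℤ))) ν₂ := fun s j hj =>
    htwo.or_of_not_agree _ _ (hW s _ j hj) (hnot s j hj)
  have hiff : ∀ s s' (j j' : ℕ), j ≤ 7 → j' ≤ 7 →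
      (Agree η V (base s + (0, (j : ℤ))) (base s' + (0, (j' : ℤ))) ↔ c j = c j') := by
    intro s s' j j' hj hj'
    rw [hc]
    change _ ↔ code η V ν₁ (base true) j = code η V ν₁ (base true) j'
    rw [← agree_iff_code_eq htwo.ne (hor true j hj) (hor true j' hj')]
    exact ⟨fun hag => ((hW true s j hj).trans hag).trans (hW s' true j' hj'),
      fun hag => ((hW s true j hj).trans hag).trans (hW true s' j' hj')⟩
  have hext : ∀ y (j : ℕ), j ≤ 7 → Agree η V y (base true + (0, (j : ℤ))) →
      ∃ s, Agree η S y (base s + (0, (j : ℤ))) := by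
    intro y j hj hag
    rcases htwo.two_ext _ _ y (hW true false j hj) (hnot true j hj) hag with h' | h'
    · exact ⟨true, h'⟩
    · exact ⟨false, h'⟩
  have hcl : ∀ j j' : ℕ, j ≤ 7 → j' ≤ 7 → c j = c j' → ∀ s, ∃ s', h s j = h s' j' ∧
      h s (j + 1) = h s' (j' + 1) ∧ h s (j + 2) = h s' (j' + 2) := by
    intro j j' hj hj' hcc s
    obtain ⟨s', hs'⟩ := hext (base s + (0, (j : ℤ))) j' hj' ((hiff s true j j' hj hj').2 hcc)
    refine ⟨s', ?_⟩
    have g0 := hs' (0, 0) ⟨le_rfl, Or.inl ⟨rfl, by simp only; omega⟩⟩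
    have g1 := hs' (0, 1) ⟨le_rfl, Or.inr (Or.inl ⟨rfl, by simp only; omega⟩)⟩
    have g2 := hs' (0, 2) ⟨le_rfl, Or.inr (Or.inr ⟨rfl, by simp only; omega⟩)⟩
    rw [apply_add_window η, apply_add_window η] at g0 g1 g2
    rw [zero_add, zero_add] at g0
    rw [add_comm 1 (j : ℤ), add_comm 1 (j' : ℤ)] at g1
    rw [add_comm 2 (j : ℤ), add_comm 2 (j' : ℤ)] at g2
    refine ⟨g0, ?_, ?_⟩ <;> simp only [hh] <;> push_cast <;> assumption
  -- The set of the two pairs of consecutive letters, taken over both configurations, does not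
  -- depend on the height, because the code is rich.
  set Q : ℕ → Set (A × A) := fun j => Set.range fun s => (h s j, h s (j + 1)) with hQ
  have hQ0 : ∀ j, j ≤ 8 → Q j = Q 0 := by
    have hsub0 : ∀ j j', j ≤ 7 → j' ≤ 7 → c j = c j' → Q j ⊆ Q j' := by
      rintro j j' hj hj' hcc _ ⟨s, rfl⟩
      obtain ⟨s', e0, e1, -⟩ := hcl j j' hj hj' hcc s
      exact ⟨s', Prod.ext e0.symm e1.symm⟩
    have hsub1 : ∀ j j', j ≤ 7 → j' ≤ 7 → c j = c j' → Q (j + 1) ⊆ Q (j' + 1) := by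
      rintro j j' hj hj' hcc _ ⟨s, rfl⟩
      obtain ⟨s', -, e1, e2⟩ := hcl j j' hj hj' hcc s
      exact ⟨s', Prod.ext e1.symm e2.symm⟩
    exact hrich.const_two (F := fun _ => Q)
      (fun _ j j' hj hj' hcc => (hsub0 j j' hj hj' hcc).antisymm (hsub0 j' j hj' hj hcc.symm))
      (fun _ j j' hj hj' hcc => (hsub1 j j' hj hj' hcc).antisymm (hsub1 j' j hj' hj hcc.symm)) true
  have hstep : ∀ j, j ≤ 8 → ∀ s, ∃ s', h s j = h s' 0 ∧ h s (j + 1) = h s' 1 := by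
    intro j hj s
    have : (h s j, h s (j + 1)) ∈ Q 0 := by
      rw [← hQ0 j hj]
      exact ⟨s, rfl⟩
    obtain ⟨s', hs'⟩ := this
    exact ⟨s', (Prod.mk.inj hs').1.symm, (Prod.mk.inj hs').2.symm⟩
  have hdif : ∀ j, j ≤ 8 → h true j = h false j → h true (j + 1) ≠ h false (j + 1) := by
    intro j hj e0 e1
    refine hdiff.differ j hj e0 ?_
    simp only [hh] at e1
    push_cast at e1
    exact e1
  -- Each configuration one row higher continues like one of the two at height `0`. This is a
  -- permutation of two states, so the columns are constant or alternate.
  choose σ hσ0 hσ1 using hstep 1 (by omega)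
  have hne : h true 0 ≠ h false 0 := by
    intro he
    have hall : ∀ s, h s 0 = h true 0 := by
      intro s
      cases s
      · exact he.symm
      · rfl
    refine hdif 0 (by omega) he ?_
    rw [zero_add, hσ0, hσ0, hall, hall (σ false)]
  have hinj : ∀ s s', h s 0 = h s' 0 → s = s' := by
    intro s s' he
    cases s <;> cases s'
    · rfl
    · exact absurd he.symm hne
    · exact absurd he hne
    · rfl
  have hinv : ∀ s, σ (σ s) = s := by
    have hσne : σ true ≠ σ false := by
      intro he
      refine hdif 1 (by omega) ?_ ?_
      · rw [hσ0, hσ0, he]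
      · rw [hσ1, hσ1, he]
    intro s
    cases hs1 : σ true <;> cases hs2 : σ false
    · exact absurd (hs1.trans hs2.symm) hσne
    · cases s
      · rw [hs2, hs1]
      · rw [hs1, hs2]
    · cases s
      · rw [hs2, hs2]
      · rw [hs1, hs1]
    · exact absurd (hs1.trans hs2.symm) hσne
  have hiter : ∀ j s, σ^[j] (σ^[j] s) = s := fun j =>
    Function.LeftInverse.iterate (f := σ) (g := σ) hinv j
  have hcol : ∀ j, j ≤ 9 → ∀ s, h s j = h (σ^[j] s) 0 := by
    intro j
    induction j with
    | zero => exact fun _ _ => rfl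
    | succ j ih =>
      intro hj s
      obtain ⟨s', e0, e1⟩ := hstep j (by omega) s
      rw [ih (by omega)] at e0
      rw [e1, hσ0, ← hinj _ _ e0, Function.iterate_succ_apply']
  -- The iterates of `σ` in `pos` follow the letter rather than the configuration, so that the
  -- column `0` shows the fixed letter `D s` along each state.
  refine CodedPair.contradiction (η := η) (a := a) (t := t) (r := r) (c := c) (σ := σ)
    (pos := fun s j => base (σ^[j] s) + (0, (j : ℤ))) (D := fun s => h s 0)
    { one_le := ht
      le_a := hta
      a_le := har
      rich := hrich
      invol := hinv
      pos_succ := ?_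
      agree_iff := fun s s' j j' hj hj' => hiff _ _ j j' hj hj'
      ambiguous := ?_
      two_ext := ?_
      col_zero := ?_
      ne := hne
      tip := hgt }
  · intro s j
    rw [Function.iterate_succ_apply, hinv]
    ext <;> simp
    ring
  · intro y y' hag hn
    rcases htwo.or_of_not_agree y y' hag hn with h1 | h1
    · obtain ⟨j, hj, hcj⟩ := hrich.exists_lt true
      have : Agree η V (base true + (0, (j : ℤ))) ν₁ := code_eq_true_iff.1 hcj
      exact ⟨j, hj.le, (h1.trans this.symm).trans (hW _ _ j hj.le)⟩
    · obtain ⟨j, hj, hcj⟩ := hrich.exists_lt false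
      have : Agree η V (base true + (0, (j : ℤ))) ν₂ := by
        refine (hor true j hj.le).resolve_left fun h1 => ?_
        exact absurd ((code_eq_true_iff.2 h1).symm.trans hcj) (by simp)
      exact ⟨j, hj.le, (h1.trans this.symm).trans (hW _ _ j hj.le)⟩
  · intro y j hj hag
    obtain ⟨s, hs⟩ := hext y j hj (hag.trans (hW _ _ j hj))
    refine ⟨σ^[j] s, ?_⟩
    simp only [hiter]
    exact hs
  · intro s j hj
    have := hcol j hj (σ^[j] s)
    rw [hiter] at this
    rw [← this]
    simp only [hh]
    rw [apply_add_window η, zero_add]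

end TallTrapezoid

end Nivat

namespace Nivat

/-! ### Sheared rectangles, for the directions `(α, 1)`. -/

section Slanted

theorem mem_trapezoid_iff {a t r : ℤ} (hta : t ≤ a) (p : ℤ × ℤ) :
    p ∈ trapezoid a t r 0 ↔ 0 ≤ p.1 ∧ 0 ≤ p.2 ∧ p.2 ≤ 2 ∧ p.1 + t * p.2 ≤ r + t ∧
      p.1 + a * p.2 ≤ r + a := by
  obtain ⟨x, y⟩ := p
  simp only [trapezoid, Set.mem_ofPred_eq]
  constructor
  · rintro ⟨h1, ⟨rfl, h2⟩ | ⟨rfl, h2⟩ | ⟨rfl, h2⟩⟩ <;> omega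
  · rintro ⟨h1, h2, h3, h4, h5⟩
    interval_cases y <;> omega

theorem isConvexLattice_trapezoid {a t r : ℤ} (hta : t ≤ a) :
    IsConvexLattice (trapezoid a t r 0) := by
  have : trapezoid a t r 0 = {p | (-1) * p.1 + 0 * p.2 ≤ 0} ∩ ({p | 0 * p.1 + (-1) * p.2 ≤ 0} ∩
      ({p | 0 * p.1 + 1 * p.2 ≤ 2} ∩ ({p | 1 * p.1 + t * p.2 ≤ r + t} ∩
        {p | 1 * p.1 + a * p.2 ≤ r + a}))) := by
    ext p
    rw [mem_trapezoid_iff hta]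
    simp only [Set.mem_inter_iff, Set.mem_ofPred_eq, zero_mul, one_mul, neg_one_mul, zero_add,
      add_zero, Left.neg_nonpos_iff]
  rw [this]
  exact (isConvexLattice_halfPlane _ _ _).inter ((isConvexLattice_halfPlane _ _ _).inter
    ((isConvexLattice_halfPlane _ _ _).inter ((isConvexLattice_halfPlane _ _ _).inter
      (isConvexLattice_halfPlane _ _ _))))

theorem isConvexLattice_extendedTrapezoid {a t r : ℤ} (ht : 0 ≤ t) (hta : t ≤ a) (har : a ≤ r) :
    IsConvexLattice (extendedTrapezoid a t r) := by
  -- The inequality `-x + y ≤ 8` only serves to exclude the point `(0, 9)`.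
  have : extendedTrapezoid a t r = {p | (-1) * p.1 + 0 * p.2 ≤ 0} ∩
      ({p | 0 * p.1 + (-1) * p.2 ≤ 0} ∩ ({p | 0 * p.1 + 1 * p.2 ≤ 9} ∩
        ({p | (-1) * p.1 + 1 * p.2 ≤ 8} ∩ ({p | 1 * p.1 + 0 * p.2 ≤ r + t} ∩
          ({p | 1 * p.1 + t * p.2 ≤ r + 8 * t} ∩ {p | 1 * p.1 + a * p.2 ≤ r + 8 * a}))))) := by
    ext ⟨x, y⟩
    simp only [extendedTrapezoid, tallTrapezoid, vseg, Set.mem_union, Set.mem_inter_iff,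
      Set.mem_ofPred_eq]
    constructor
    · rintro (⟨h1, ⟨h2, h3, h4⟩ | ⟨rfl, h2⟩ | ⟨rfl, h2⟩⟩ | ⟨rfl, h2, h3⟩)
      · interval_cases y <;> omega
      · omega
      · omega
      · interval_cases y <;> omega
    · rintro ⟨h1, h2, h3, h4, h5, h6, h7⟩
      have h2' : 0 ≤ y := by omega
      have h3' : y ≤ 9 := by omega
      interval_cases y <;> omega
  rw [this]
  exact (isConvexLattice_halfPlane _ _ _).inter ((isConvexLattice_halfPlane _ _ _).inter
    ((isConvexLattice_halfPlane _ _ _).inter ((isConvexLattice_halfPlane _ _ _).inter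
      ((isConvexLattice_halfPlane _ _ _).inter ((isConvexLattice_halfPlane _ _ _).inter
        (isConvexLattice_halfPlane _ _ _))))))

theorem one_le_ncard_slice {T : Set (ℤ × ℤ)} (hT : T.Finite) {p : ℤ × ℤ} (hp : p ∈ T) :
    1 ≤ (slice T p.1).ncard :=
  (Set.ncard_pos (hT.subset (slice_subset T _))).2 ⟨p, hp, rfl⟩

theorem ncard_slice_le {T : Set (ℤ × ℤ)} {x a b : ℤ} (hab : a ≤ b + 1)
    (h : ∀ p ∈ T, p.1 = x → a ≤ p.2 ∧ p.2 ≤ b) : ((slice T x).ncard : ℤ) ≤ b - a + 1 := by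
  rw [← ncard_vseg x hab]
  have hsub : slice T x ⊆ vseg x a b := fun p hp => ⟨hp.2, h p hp.1 hp.2⟩
  exact_mod_cast Set.ncard_le_ncard hsub (vseg_finite x a b)

theorem le_ncard_slice {T : Set (ℤ × ℤ)} (hT : T.Finite) {x a b : ℤ} (hab : a ≤ b + 1)
    (h : ∀ y, a ≤ y → y ≤ b → (x, y) ∈ T) : b - a + 1 ≤ ((slice T x).ncard : ℤ) := by
  rw [← ncard_vseg x hab]
  refine mod_cast Set.ncard_le_ncard ?_ (hT.subset (slice_subset T x))
  rintro ⟨x', y⟩ ⟨hx, h1, h2⟩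
  simp only at hx h1 h2
  subst hx
  exact ⟨h y h1 h2, rfl⟩

theorem forall_mem_of_le_ncard_slice {T : Set (ℤ × ℤ)} {x a b : ℤ}
    (h : ∀ p ∈ T, p.1 = x → a ≤ p.2 ∧ p.2 ≤ b) (hab : a ≤ b + 1)
    (hc : b - a + 1 ≤ ((slice T x).ncard : ℤ)) :
    ∀ y, a ≤ y → y ≤ b → (x, y) ∈ T := by
  have : slice T x = vseg x a b := by
    refine Set.eq_of_subset_of_ncard_le (fun p hp => ⟨hp.2, h p hp.1 hp.2⟩) ?_ (vseg_finite x a b)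
    rw [← ncard_vseg x hab] at hc
    exact_mod_cast hc
  intro y h1 h2
  have hmem : (x, y) ∈ slice T x := by
    rw [this]
    exact ⟨rfl, h1, h2⟩
  exact hmem.1

variable {A : Type*} [Finite A] {η : ℤ × ℤ → A} {a t r : ℤ}

/-- Without the vertex the left column has two points, at most one more than any other column, and
adds at least two words. The whole column of three adds at most two, so the vertex adds none. -/
theorem generates_left_vertex (hne : IsVerticallyNonexpansive η) (hb : ¬ HasVerticalBalanced η)
    (ht : 1 ≤ t) (hta : t ≤ a) (har : a ≤ r)
    (h2 : complexity η (trapezoid a t r 0) ≤ complexity η (trapezoid a t r 1) + 2)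
    {y u v : ℤ} (hy : y = 0 ∨ y = 2) (huv : u + 2 = v)
    (hmem : ∀ p ∈ trapezoid a t r 0, p.1 = 0 → p ≠ (0, y) → u + 1 ≤ p.2 ∧ p.2 ≤ v)
    (hconv : IsConvexLattice (trapezoid a t r 0 \ {(0, y)})) 
    (hin : ∀ y', u + 1 ≤ y' → y' ≤ v → (0, y') ∈ trapezoid a t r 0 \ {(0, y)}) :
    Generates η (trapezoid a t r 0) (0, y) := by
  have hfin := (trapezoid_finite a t r 0).subset (Set.sdiff_subset (t := {((0 : ℤ), y)}))
  refine generates_of_complexity_le (trapezoid_finite a t r 0) ?_ rfl (h2.trans ?_)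
  · rcases hy with rfl | rfl
    · exact ⟨le_rfl, Or.inl ⟨rfl, by simp only; omega⟩⟩
    · exact ⟨le_rfl, Or.inr (Or.inr ⟨rfl, by simp only; omega⟩)⟩
  have hle := ncard_slice_le (T := trapezoid a t r 0 \ {(0, y)}) (x := 0) (a := u + 1) (b := v)
    (by omega) fun p hp hp0 => hmem p hp.1 hp0 hp.2
  have hge := le_ncard_slice hfin (x := 0) (a := u + 1) (b := v) (by omega) hin
  have key := complexity_add_ncard_slice_le hne hb hfin hconv (x := 0) (fun p hp => hp.1.1)
    ⟨(1, 0), ⟨⟨by simp, Or.inl ⟨rfl, by simp only; omega⟩⟩, fun h => by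
      simpa using congrArg Prod.fst h⟩, by simp⟩
    (fun p hp => by have := one_le_ncard_slice hfin hp; omega)
  have e : {p | p ∈ trapezoid a t r 0 \ {(0, y)} ∧ 0 < p.1} = trapezoid a t r 1 := by
    ext p
    simp only [trapezoid, Set.mem_ofPred_eq, Set.mem_sdiff, Set.mem_singleton_iff]
    constructor
    · rintro ⟨⟨⟨-, h⟩, -⟩, h'⟩
      exact ⟨h', h⟩
    · rintro ⟨h', h⟩
      refine ⟨⟨⟨by omega, h⟩, ?_⟩, by omega⟩
      rintro rfl
      simp at h'
  rw [e] at key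
  omega

/-- If the bound fails for the trapezoid but holds without its left column and without its tip, then
the tip is generated and the left column adds at most two words. This also makes the two left
vertices generated, and the tall trapezoid yields a contradiction. -/
theorem ncard_trapezoid_lt_complexity (hne : IsVerticallyNonexpansive η)
    (hb : ¬ HasVerticalBalanced η) (ht : 1 ≤ t) (hta : t ≤ a) (har : a ≤ r)
    (h1 : (trapezoid a t r 1).ncard < complexity η (trapezoid a t r 1))
    (h2 : (trapezoid a (t - 1) r 0).ncard < complexity η (trapezoid a (t - 1) r 0)) :
    (trapezoid a t r 0).ncard < complexity η (trapezoid a t r 0) := by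
  by_contra! hcon
  have hconv := isConvexLattice_trapezoid (r := r) hta
  have hcard : (trapezoid a t r 0).ncard = (trapezoid a t r 1).ncard + 3 := by
    have e : trapezoid a t r 0 = trapezoid a t r 1 ∪ vseg 0 0 2 := by
      ext ⟨x, y⟩
      simp only [trapezoid, vseg, Set.mem_union, Set.mem_ofPred_eq]
      omega
    have hd : Disjoint (trapezoid a t r 1) (vseg 0 0 2) := by
      rw [Set.disjoint_left]
      rintro ⟨x, y⟩ ⟨hx, -⟩ ⟨hx', -⟩
      simp only at hx hx'
      omega
    rw [e, Set.ncard_union_eq hd (trapezoid_finite a t r 1) (vseg_finite 0 0 2)]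
    have := ncard_vseg 0 (a := 0) (b := 2) (by norm_num)
    omega
  have htip : trapezoid a (t - 1) r 0 = trapezoid a t r 0 \ {(r + t, 0)} := by
    ext ⟨x, y⟩
    simp only [trapezoid, Set.mem_sdiff, Set.mem_ofPred_eq, Set.mem_singleton_iff, Prod.mk.injEq]
    omega
  have hmem : (r + t, (0 : ℤ)) ∈ trapezoid a t r 0 :=
    ⟨by simp only; omega, Or.inl ⟨rfl, le_rfl⟩⟩
  have hcard' : (trapezoid a t r 0).ncard = (trapezoid a (t - 1) r 0).ncard + 1 := by
    rw [htip, Set.ncard_sdiff_singleton_add_one hmem (trapezoid_finite a t r 0)]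
  have hgt := generates_of_complexity_le (η := η) (trapezoid_finite a t r 0) hmem htip (by omega)
  have hV : complexity η (trapezoid a t r 0) ≤ complexity η (trapezoid a t r 1) + 2 := by omega
  have hg0 : Generates η (trapezoid a t r 0) (0, 0) := by
    refine generates_left_vertex hne hb ht hta har hV (Or.inl rfl) (u := 0) (v := 2) (by norm_num)
      ?_ ?_ ?_
    · rintro ⟨x, y⟩ ⟨-, h⟩ hx hy
      simp only [ne_eq, Prod.mk.injEq] at h hx hy ⊢
      omega
    · have e : trapezoid a t r 0 \ {(0, 0)} =
          trapezoid a t r 0 ∩ {p | (-1) * p.1 + (-1) * p.2 ≤ -1} := by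
        ext ⟨x, y⟩
        simp only [trapezoid, Set.mem_sdiff, Set.mem_inter_iff, Set.mem_ofPred_eq,
          Set.mem_singleton_iff, Prod.mk.injEq]
        omega
      rw [e]
      exact hconv.inter (isConvexLattice_halfPlane _ _ _)
    · intro y h h'
      simp only [trapezoid, Set.mem_sdiff, Set.mem_ofPred_eq, Set.mem_singleton_iff,
        Prod.mk.injEq]
      omega
  have hg2 : Generates η (trapezoid a t r 0) (0, 2) := by
    refine generates_left_vertex hne hb ht hta har hV (Or.inr rfl) (u := -1) (v := 1) (by norm_num)
      ?_ ?_ ?_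
    · rintro ⟨x, y⟩ ⟨-, h⟩ hx hy
      simp only [ne_eq, Prod.mk.injEq] at h hx hy ⊢
      omega
    · have e : trapezoid a t r 0 \ {(0, 2)} =
          trapezoid a t r 0 ∩ {p | (-1) * p.1 + 1 * p.2 ≤ 1} := by
        ext ⟨x, y⟩
        simp only [trapezoid, Set.mem_sdiff, Set.mem_inter_iff, Set.mem_ofPred_eq,
          Set.mem_singleton_iff, Prod.mk.injEq]
        omega
      rw [e]
      exact hconv.inter (isConvexLattice_halfPlane _ _ _)
    · intro y h h'
      simp only [trapezoid, Set.mem_sdiff, Set.mem_ofPred_eq, Set.mem_singleton_iff,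
        Prod.mk.injEq]
      omega
  have hlt := complexity_extendedTrapezoid_lt ht hta har hg0 hg2 hgt hV
  have hEfin := extendedTrapezoid_finite a t r
  have hmemE : ∀ x y : ℤ, (x, y) ∈ extendedTrapezoid a t r → x = 0 → 0 ≤ y ∧ y ≤ 8 := by
    intro x y h hx
    simp only [extendedTrapezoid, tallTrapezoid, vseg, Set.mem_union, Set.mem_ofPred_eq] at h
    omega
  have hle := ncard_slice_le (T := extendedTrapezoid a t r) (x := 0) (a := 0) (b := 8)
    (by norm_num) fun p hp hp0 => hmemE p.1 p.2 hp hp0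
  have hge := le_ncard_slice hEfin (x := 0) (a := 0) (b := 8) (by norm_num)
    fun y h h' => Or.inr ⟨rfl, h, h'⟩
  -- The column of nine points may be removed, since every other column contains the eight rows from
  -- `0` to `7`.
  have key := complexity_add_ncard_slice_le hne hb hEfin
    (isConvexLattice_extendedTrapezoid (by omega) hta har) (x := 0) ?_ ?_ ?_
  · have e : {p | p ∈ extendedTrapezoid a t r ∧ 0 < p.1} = tallTrapezoid a t r 1 := by
      ext ⟨x, y⟩
      simp only [extendedTrapezoid, tallTrapezoid, vseg, Set.mem_union, Set.mem_ofPred_eq]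
      omega
    rw [e] at key
    omega
  · rintro ⟨x, y⟩ hp
    simp only [extendedTrapezoid, tallTrapezoid, vseg, Set.mem_union, Set.mem_ofPred_eq] at hp ⊢
    omega
  · exact ⟨(1, 0), Or.inl ⟨le_rfl, Or.inl ⟨le_rfl, by norm_num, by simp only; omega⟩⟩, by simp⟩
  · rintro ⟨x, y⟩ hp
    have := le_ncard_slice hEfin (x := x) (a := 0) (b := 7) (by norm_num) ?_
    · simp only
      omega
    · intro y' h h'
      simp only [extendedTrapezoid, tallTrapezoid, vseg, Set.mem_union, Set.mem_ofPred_eq] at hp ⊢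
      omega

/-- A sheared rectangle with three rows, cut off to the left of the column `L` and at the right end
of the lowest row. -/
def shearedRect (a N J L : ℤ) : Set (ℤ × ℤ) :=
  {p | L ≤ p.1 ∧ ((p.2 = 0 ∧ 0 ≤ p.1 ∧ p.1 ≤ N - J) ∨ (p.2 = 1 ∧ -a ≤ p.1 ∧ p.1 ≤ N - a) ∨
    (p.2 = 2 ∧ -(2 * a) ≤ p.1 ∧ p.1 ≤ N - 2 * a))}

theorem shearedRect_finite (a N J L : ℤ) : (shearedRect a N J L).Finite := by
  refine ((Set.finite_Icc L (max (N - J) (max (N - a) (N - 2 * a)))).prod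
    (Set.finite_Icc (0 : ℤ) 2)).subset ?_
  rintro ⟨x, y⟩ ⟨h1, h2⟩
  simp only at h1 h2
  refine ⟨⟨h1, ?_⟩, ?_, ?_⟩ <;> simp only <;> omega

theorem isConvexLattice_shearedRect {a N J L : ℤ} (hJ : 0 ≤ J) (hJa : J ≤ a) :
    IsConvexLattice (shearedRect a N J L) := by
  have : shearedRect a N J L = {p | (-1) * p.1 + 0 * p.2 ≤ -L} ∩
      ({p | 0 * p.1 + (-1) * p.2 ≤ 0} ∩ ({p | 0 * p.1 + 1 * p.2 ≤ 2} ∩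
        ({p | (-1) * p.1 + (-a) * p.2 ≤ 0} ∩ ({p | 1 * p.1 + a * p.2 ≤ N} ∩
          {p | 1 * p.1 + (a - J) * p.2 ≤ N - J})))) := by
    ext ⟨x, y⟩
    simp only [shearedRect, Set.mem_inter_iff, Set.mem_ofPred_eq]
    constructor
    · rintro ⟨h1, ⟨rfl, h2⟩ | ⟨rfl, h2⟩ | ⟨rfl, h2⟩⟩ <;> omega
    · rintro ⟨h1, h2, h3, h4, h5, h6⟩
      have h2' : 0 ≤ y := by omega
      have h3' : y ≤ 2 := by omega
      interval_cases y <;> omega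
  rw [this]
  exact (isConvexLattice_halfPlane _ _ _).inter ((isConvexLattice_halfPlane _ _ _).inter
    ((isConvexLattice_halfPlane _ _ _).inter ((isConvexLattice_halfPlane _ _ _).inter
      ((isConvexLattice_halfPlane _ _ _).inter (isConvexLattice_halfPlane _ _ _)))))

theorem ncard_translate (v : ℤ × ℤ) (T : Set (ℤ × ℤ)) : {p | p + v ∈ T}.ncard = T.ncard :=
  Set.ncard_preimage_of_injective_subset_range (add_left_injective v)
    (fun q _ => ⟨q - v, sub_add_cancel q v⟩)

/-- Columns are added from right to left, starting from the empty set. Columns of at most two points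
are covered by the removal lemma, a lone column by aperiodicity. A column of three points makes the
set a translate of a trapezoid, whose version without the tip is the case `J + 1`. -/
theorem ncard_shearedRect_lt_complexity_of_succ (hne : IsVerticallyNonexpansive η)
    (hb : ¬ HasVerticalBalanced η) (hper : ¬ Periodic η) {N J : ℤ} (hJ : 0 ≤ J) (hJa : J < a)
    (ih : ∀ L : ℤ, (shearedRect a N (J + 1) L).ncard < complexity η (shearedRect a N (J + 1) L))
    (L : ℤ) : (shearedRect a N J L).ncard < complexity η (shearedRect a N J L) := by
  have hM : ∃ m : ℕ, (max (N + 1) (max (N - a + 1) (N - 2 * a + 1)) - L).toNat = m := ⟨_, rfl⟩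
  obtain ⟨m, hm⟩ := hM
  induction m generalizing L with
  | zero =>
    have : shearedRect a N J L = ∅ := by
      rw [Set.eq_empty_iff_forall_notMem]
      rintro ⟨x, y⟩ h
      simp only [shearedRect, Set.mem_ofPred_eq] at h
      omega
    rw [this, Set.ncard_empty]
    exact one_le_complexity η Set.finite_empty
  | succ m ihm =>
    have hL := ihm (L + 1) (by omega)
    have hfin := shearedRect_finite a N J L
    have hconv := isConvexLattice_shearedRect (N := N) (L := L) (J := J)
      hJ hJa.le
    by_contra! hcon
    have hright : {p | p ∈ shearedRect a N J L ∧ L < p.1} =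
        shearedRect a N (J) (L + 1) := by
      ext ⟨x, y⟩
      simp only [shearedRect, Set.mem_ofPred_eq]
      omega
    have hcard : (shearedRect a N J L).ncard =
        (shearedRect a N (J) (L + 1)).ncard +
          (slice (shearedRect a N J L) L).ncard := by
      rw [← hright, ← Set.ncard_union_eq _ (hfin.subset fun p h => h.1)
        (hfin.subset (slice_subset _ _))]
      · congr 1
        ext p
        constructor
        · intro hp
          rcases eq_or_lt_of_le hp.1 with h | h
          · exact Or.inr ⟨hp, h.symm⟩
          · exact Or.inl ⟨hp, h⟩
        · rintro (h | h) <;> exact h.1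
      · rw [Set.disjoint_left]
        rintro p ⟨-, h⟩ ⟨-, h'⟩
        omega
    have hcolumn : ∀ s ∈ shearedRect a N J L, s.1 = L → 0 ≤ s.2 ∧ s.2 ≤ 2 := by
      rintro s ⟨-, h⟩ -
      omega
    have hsl := ncard_slice_le (by norm_num) hcolumn
    have hbig : 3 ≤ (slice (shearedRect a N J L) L).ncard := by
      by_cases hr : ∃ p ∈ shearedRect a N J L, L < p.1
      · by_contra! hlt
        have := complexity_add_ncard_slice_le hne hb hfin hconv (x := L) (fun p hp => hp.1) hr
          (fun p hp => by have := one_le_ncard_slice hfin hp; omega)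
        rw [hright] at this
        omega
      · push Not at hr
        have hmono : complexity η (shearedRect a N J (L + 1)) ≤ complexity η (shearedRect a N J L) := by
          rw [← hright]
          exact complexity_mono η (fun p h => h.1) hfin
        have hne' : (slice (shearedRect a N J L) L).Nonempty := by
          rw [← Set.ncard_pos (hfin.subset (slice_subset _ _))]
          omega
        obtain ⟨u, v, huv, he⟩ := hconv.slice_eq_vseg hfin hne'
        have he' : shearedRect a N J L = vseg L u v := by
          rw [← he]
          ext p
          exact ⟨fun h => ⟨h, le_antisymm (hr p h) h.1⟩, fun h => h.1⟩
        rw [he', complexity_vseg] at hcon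
        have h1 := ncard_vseg L (a := u) (b := v) (by omega)
        have h2 := lt_complexity_column hper (v - u + 1).toNat
        omega
    have hall := forall_mem_of_le_ncard_slice hcolumn (by norm_num) (by omega)
    have hm0 := hall 0 (by norm_num) (by norm_num)
    have hm2 := hall 2 (by norm_num) (by norm_num)
    simp only [shearedRect, Set.mem_ofPred_eq] at hm0 hm2
    -- Once the column `L` has all three points, `L` is nonnegative, so the slanted left side has
    -- been cut off.
    have e : ∀ j l : ℤ, 0 ≤ l → {p | p + (L, 0) ∈ shearedRect a N j (L + l)} =
        trapezoid a (a - j) (N - a - L) l := by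
      intro j l hl
      ext ⟨x, y⟩
      simp only [shearedRect, trapezoid, Set.mem_ofPred_eq, Prod.mk_add_mk]
      omega
    have h1 := ncard_trapezoid_lt_complexity hne hb (a := a) (t := a - J) (r := N - a - L)
      (by omega) (by omega) (by omega) ?_ ?_
    · rw [← e _ _ le_rfl, ncard_translate, complexity_translate, add_zero] at h1
      omega
    · rw [← e _ _ zero_le_one, ncard_translate, complexity_translate]
      exact hL
    · rw [sub_sub, ← e _ _ le_rfl, ncard_translate, complexity_translate]
      exact ih _

theorem ncard_shearedRect_lt_complexity (hne : IsVerticallyNonexpansive η)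
    (hb : ¬ HasVerticalBalanced η) (hper : ¬ Periodic η) {N : ℤ} (k : ℕ) :
    ∀ J : ℤ, 0 ≤ J → J + k = a → ∀ L : ℤ,
      (shearedRect a N J L).ncard < complexity η (shearedRect a N J L) := by
  induction k with
  | zero =>
    intro J hJ hJa L
    -- For `J = a` the rows `0` and `1` end at the same column. To the right of a column of three
    -- points, every nonempty column contains these two rows.
    obtain rfl : J = a := by simpa using hJa
    have hfin := shearedRect_finite J N J L
    refine ncard_lt_complexity hne hb hper hfin (isConvexLattice_shearedRect hJ le_rfl) ?_
    intro p hp q hq hpq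
    have h0 : ∀ s ∈ shearedRect J N J L, s.1 = p.1 → 0 ≤ s.2 ∧ s.2 ≤ 2 := by
      rintro s ⟨-, h⟩ -
      omega
    have h1 := ncard_slice_le (by norm_num) h0
    have h2 := one_le_ncard_slice hfin hq
    by_contra! hlt
    have h4 : 0 ≤ p.1 := by
      have := (forall_mem_of_le_ncard_slice h0 (by norm_num) (by omega) 0 (by norm_num)
        (by norm_num)).2
      simp only at this
      omega
    have h5 := le_ncard_slice hfin (x := q.1) (a := 0) (b := 1) (by norm_num) ?_
    · omega
    · intro y h h'
      simp only [shearedRect, Set.mem_ofPred_eq] at hq ⊢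
      omega
  | succ k ih =>
    intro J hJ hJa
    push_cast at hJa
    exact ncard_shearedRect_lt_complexity_of_succ hne hb hper hJ (by omega)
      (ih (J + 1) (by omega) (by omega))

end Slanted

end Nivat

namespace Nivat

/-! ### Consequences of nonexpansiveness for finite windows. -/

section Nonexpansive

variable {A : Type*}

theorem cross_toPlane_add (v : ℝ × ℝ) (p q : ℤ × ℤ) :
    cross v (toPlane (p + q)) = cross v (toPlane p) + cross v (toPlane q) := by
  simp only [cross, toPlane, Prod.fst_add, Prod.snd_add]
  push_cast
  ring

theorem cross_toPlane_sub (v : ℝ × ℝ) (p q : ℤ × ℤ) :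
    cross v (toPlane (p - q)) = cross v (toPlane p) - cross v (toPlane q) := by
  simp only [cross, toPlane, Prod.fst_sub, Prod.snd_sub]
  push_cast
  ring

theorem exists_shift_eq_of_mem_orbitClosure [TopologicalSpace A] [DiscreteTopology A]
    {η f : ℤ × ℤ → A} (hf : f ∈ orbitClosure η) {F : Set (ℤ × ℤ)} (hF : F.Finite) :
    ∃ u, ∀ x ∈ F, η (x + u) = f x := by
  obtain ⟨g, hg, u, rfl⟩ := mem_closure_iff.1 hf (F.pi fun x => {f x})
    (isOpen_set_pi hF fun x _ => isOpen_discrete _) fun x _ => rfl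
  exact ⟨u, hg⟩

/-- Two configurations that agree on the half-plane are translated so that `p` lies at a nearly
extremal point of disagreement, with all of `V` beyond the supremum. They are then approximated on a
finite set by translates of `η`. -/
theorem IsNonexpansiveDirection.exists_agree [TopologicalSpace A] [DiscreteTopology A]
    {η : ℤ × ℤ → A} {ℓ : DirectedLine} (hℓ : IsNonexpansiveDirection η ℓ) {V : Set (ℤ × ℤ)}
    (hV : V.Finite) {p : ℤ × ℤ}
    (hp : ∀ v ∈ V, cross ℓ.dir (toPlane p) < cross ℓ.dir (toPlane v)) :
    ∃ z z', Agree η V z z' ∧ η (p + z) ≠ η (p + z') := by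
  obtain ⟨f, hf, g, hg, hfg, heq⟩ := hℓ
  set φ : ℤ × ℤ → ℝ := fun q => cross ℓ.dir (toPlane q) with hφ
  obtain ⟨ε, hε, hεV⟩ : ∃ ε > 0, ∀ v ∈ V, φ p + ε ≤ φ v := by
    rcases V.eq_empty_or_nonempty with rfl | hne
    · exact ⟨1, one_pos, by simp⟩
    · obtain ⟨v, hv, hmin⟩ := Set.exists_min_image V φ hV hne
      exact ⟨φ v - φ p, sub_pos.2 (hp v hv), fun w hw => by linarith [hmin w hw]⟩
  -- For an irrational direction the supremum need not be attained, so a point within the gap `ε` of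
  -- it is taken.
  set D : Set ℝ := φ '' {q | f q ≠ g q} with hD
  have hne : D.Nonempty := by
    obtain ⟨q, hq⟩ := Function.ne_iff.1 hfg
    exact ⟨_, q, hq, rfl⟩
  have hbdd : BddAbove D := by
    refine ⟨0, ?_⟩
    rintro _ ⟨q, hq, rfl⟩
    by_contra! h
    exact hq (heq (show 0 ≤ cross ℓ.dir (toPlane q) from h.le))
  obtain ⟨_, ⟨q, hq, rfl⟩, hlt⟩ := exists_lt_of_lt_csSup hne (sub_lt_self (sSup D) hε)
  have hagree : ∀ v ∈ V, f (v + (q - p)) = g (v + (q - p)) := by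
    intro v hv
    by_contra h
    have h1 := le_csSup hbdd ⟨_, h, rfl⟩
    have h2 : φ (v + (q - p)) = φ v + (φ q - φ p) := by
      simp only [hφ, cross_toPlane_add, cross_toPlane_sub]
    have := hεV v hv
    linarith
  have hfin : ((fun v => v + (q - p)) '' insert p V).Finite := (hV.insert p).image _
  obtain ⟨u, hu⟩ := exists_shift_eq_of_mem_orbitClosure hf hfin
  obtain ⟨u', hu'⟩ := exists_shift_eq_of_mem_orbitClosure hg hfin
  have h1 : ∀ v ∈ insert p V, η (v + ((q - p) + u)) = f (v + (q - p)) := fun v hv => by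
    rw [← add_assoc]
    exact hu _ ⟨v, hv, rfl⟩
  have h2 : ∀ v ∈ insert p V, η (v + ((q - p) + u')) = g (v + (q - p)) := fun v hv => by
    rw [← add_assoc]
    exact hu' _ ⟨v, hv, rfl⟩
  refine ⟨(q - p) + u, (q - p) + u', fun v hv => ?_, ?_⟩
  · rw [h1 v (Set.mem_insert_of_mem p hv), h2 v (Set.mem_insert_of_mem p hv), hagree v hv]
  · rw [h1 p (Set.mem_insert p V), h2 p (Set.mem_insert p V), add_sub_cancel]
    exact hq

/-- When no line parallel to the direction contains two points of the set, the points can be removed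
one by one, each losing a word. -/
theorem IsNonexpansiveDirection.ncard_lt_complexity [Finite A] [TopologicalSpace A]
    [DiscreteTopology A] {η : ℤ × ℤ → A} {ℓ : DirectedLine} (hℓ : IsNonexpansiveDirection η ℓ)
    {T : Set (ℤ × ℤ)} (hT : T.Finite) (hinj : Set.InjOn (fun q => cross ℓ.dir (toPlane q)) T) :
    T.ncard < complexity η T := by
  induction hn : T.ncard generalizing T with
  | zero => exact one_le_complexity η hT
  | succ n ih =>
    have hne : T.Nonempty := by
      rw [← Set.ncard_pos hT]
      omega
    obtain ⟨p, hp, hmin⟩ := Set.exists_min_image T (fun q => cross ℓ.dir (toPlane q)) hT hne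
    have hV := hT.subset (Set.sdiff_subset (t := {p}))
    have h1 := ih hV (hinj.mono Set.sdiff_subset) (by
      have := Set.ncard_sdiff_singleton_add_one hp hT
      omega)
    obtain ⟨z, z', hag, hnot⟩ := hℓ.exists_agree hV (p := p) fun v hv =>
      lt_of_le_of_ne (hmin v hv.1) fun h => hv.2 (hinj hv.1 hp h.symm)
    have h2 := complexity_lt_of_not_agree Set.sdiff_subset hT hag fun h => hnot (h p hp)
    omega

theorem rect_finite (n k : ℕ) : (rect n k).Finite :=
  (Set.finite_Ico _ _).prod (Set.finite_Ico _ _)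

theorem ncard_rect (n k : ℕ) : (rect n k).ncard = n * k := by
  rw [rect, Set.ncard_prod, ← Finset.coe_Ico, ← Finset.coe_Ico, Set.ncard_coe_finset,
    Set.ncard_coe_finset, Int.card_Ico, Int.card_Ico]
  simp

/-- Possible directions if two points of a strip of three rows lie on a line parallel to `v`. -/
theorem exists_smul_of_cross_eq {n : ℕ} {v : ℝ × ℝ} (hv : v ≠ 0)
    (h : ¬ Set.InjOn (fun q => cross v (toPlane q)) (rect n 3)) :
    ∃ c : ℝ, c ≠ 0 ∧ (v = c • toPlane (1, 0) ∨ (∃ α : ℤ, v = c • toPlane (α, 1)) ∨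
      ∃ m : ℤ, v = c • toPlane (2 * m + 1, 2)) := by
  have hex : ∃ i j : ℤ, 0 ≤ j ∧ j ≤ 2 ∧ (i, j) ≠ 0 ∧ cross v (toPlane (i, j)) = 0 := by
    unfold Set.InjOn at h
    push Not at h
    obtain ⟨p, ⟨-, hp1, hp2⟩, q, ⟨-, hq1, hq2⟩, heq, hpq⟩ := h
    change cross v (toPlane p) = cross v (toPlane q) at heq
    push_cast at hp2 hq2
    rcases le_total q.2 p.2 with hle | hle
    · refine ⟨p.1 - q.1, p.2 - q.2, by omega, by omega, sub_ne_zero.2 hpq, ?_⟩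
      have := cross_toPlane_sub v p q
      rw [heq, sub_self] at this
      exact this
    · refine ⟨q.1 - p.1, q.2 - p.2, by omega, by omega, sub_ne_zero.2 hpq.symm, ?_⟩
      have := cross_toPlane_sub v q p
      rw [heq, sub_self] at this
      exact this
  obtain ⟨i, j, hj0, hj2, hne, hcr⟩ := hex
  obtain ⟨v1, v2⟩ := v
  simp only [cross, toPlane] at hcr
  have hv2 : ∀ k : ℤ, k ≠ 0 → v1 * (k : ℝ) = v2 * (i : ℝ) → v2 ≠ 0 := by
    rintro k hk hk' rfl
    rw [zero_mul, mul_eq_zero] at hk'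
    have : v1 = 0 := hk'.resolve_right (by exact_mod_cast hk)
    exact hv (by rw [this]; rfl)
  obtain rfl | rfl | rfl : j = 0 ∨ j = 1 ∨ j = 2 := by omega
  · have hi : i ≠ 0 := fun h => hne (by rw [h]; rfl)
    have hv2' : v2 = 0 := by
      have : v2 * (i : ℝ) = 0 := by push_cast at hcr; linarith
      exact (mul_eq_zero.1 this).resolve_right (by exact_mod_cast hi)
    refine ⟨v1, fun h => hv (by rw [h, hv2']; rfl), Or.inl ?_⟩
    ext <;> simp [toPlane, hv2']
  · push_cast at hcr
    refine ⟨v2, hv2 1 one_ne_zero (by push_cast; linarith), Or.inr (Or.inl ⟨i, ?_⟩)⟩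
    ext <;> simp [toPlane]
    linarith
  · push_cast at hcr
    have h2 := hv2 2 two_ne_zero (by push_cast; linarith)
    -- A difference `(i, 2)` with `i` even is not primitive and reduces to the case `(α, 1)`.
    rcases Int.even_or_odd' i with ⟨m, rfl | rfl⟩
    · refine ⟨v2, h2, Or.inr (Or.inl ⟨m, ?_⟩)⟩
      push_cast at hcr
      ext <;> simp [toPlane]
      linarith
    · refine ⟨v2 / 2, div_ne_zero h2 two_ne_zero, Or.inr (Or.inr ⟨m, ?_⟩)⟩
      push_cast at hcr
      ext <;> simp [toPlane]
      linarith

end Nonexpansive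

end Nivat

namespace Nivat

/-! ### Lattice bases adapted to the line. -/

section Frames

/-- Three points with nonzero determinant span the plane affinely, so the hull has interior points.
-/
theorem volume_hull_pos {S : Set (ℤ × ℤ)} {p q r : ℤ × ℤ} (hp : p ∈ S) (hq : q ∈ S) (hr : r ∈ S)
    (h : cross (toPlane q - toPlane p) (toPlane r - toPlane p) ≠ 0) : 0 < volume (hull S) := by
  have htop : affineSpan ℝ (toPlane '' S) = ⊤ := by
    rw [eq_top_iff]
    intro x _
    have mem : ∀ s ∈ S, toPlane s ∈ affineSpan ℝ (toPlane '' S) := fun s hs =>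
      subset_affineSpan ℝ _ ⟨s, hs, rfl⟩
    set u := toPlane q - toPlane p with hu
    set v := toPlane r - toPlane p with hv
    have h1 := (affineSpan ℝ (toPlane '' S)).smul_vsub_vadd_mem
      (cross (x - toPlane p) v / cross u v) (mem q hq) (mem p hp) (mem p hp)
    have h2 := (affineSpan ℝ (toPlane '' S)).smul_vsub_vadd_mem
      (cross u (x - toPlane p) / cross u v) (mem r hr) (mem p hp) h1
    convert h2 using 1
    rw [vsub_eq_sub, vsub_eq_sub, vadd_eq_add, vadd_eq_add, ← hu, ← hv]
    have e : cross u v • (x - toPlane p) =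
        cross u (x - toPlane p) • v + cross (x - toPlane p) v • u := by
      ext <;> simp [cross] <;> ring
    have e' : x - toPlane p = (cross u (x - toPlane p) / cross u v) • v +
        (cross (x - toPlane p) v / cross u v) • u := by
      rw [div_eq_inv_mul, div_eq_inv_mul, mul_smul, mul_smul, ← smul_add, ← e, smul_smul,
        inv_mul_cancel₀ h, one_smul]
    rw [← add_assoc, ← e', sub_add_cancel]
  have hint := interior_convexHull_nonempty_iff_affineSpan_eq_top.2 htop
  exact (isOpen_interior.measure_pos volume hint).trans_le (measure_mono interior_subset)

/-- A basis `e, d` of the lattice with `d` in the direction of the line and `e` on its left. -/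
structure IsFrame (ℓ : DirectedLine) (e d : ℤ × ℤ) (s : ℤ) (c : ℝ) : Prop where
  det : d.1 * e.2 - d.2 * e.1 = s
  sq : s * s = 1
  dir : ℓ.dir = c • toPlane d
  pos : 0 < c * s

/-- The lattice point with given coordinates. -/
def latticePoint (e d p : ℤ × ℤ) : ℤ × ℤ := (p.1 * e.1 + p.2 * d.1, p.1 * e.2 + p.2 * d.2)

/-- The coordinates of a point of the plane. -/
noncomputable def coords (e d : ℤ × ℤ) (s : ℤ) : ℝ × ℝ →ₗ[ℝ] ℝ × ℝ where
  toFun x := (s * cross (toPlane d) x, s * cross x (toPlane e))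
  map_add' x y := by
    ext <;> simp [cross] <;> ring
  map_smul' r x := by
    ext <;> simp [cross] <;> ring

theorem latticePoint_add (e d p q : ℤ × ℤ) :
    latticePoint e d (p + q) = latticePoint e d p + latticePoint e d q := by
  ext <;> simp [latticePoint] <;> ring

variable {ℓ : DirectedLine} {e d : ℤ × ℤ} {s : ℤ} {c : ℝ}

namespace IsFrame

theorem det_real (h : IsFrame ℓ e d s c) : (d.1 : ℝ) * e.2 - d.2 * e.1 = s := by
  exact_mod_cast h.det

theorem sq_real (h : IsFrame ℓ e d s c) : (s : ℝ) * s = 1 := by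
  exact_mod_cast h.sq

theorem coords_latticePoint (h : IsFrame ℓ e d s c) (p : ℤ × ℤ) :
    coords e d s (toPlane (latticePoint e d p)) = toPlane p := by
  have h1 := h.det_real
  have h2 := h.sq_real
  ext
  · simp only [coords, cross, toPlane, latticePoint, LinearMap.coe_mk, AddHom.coe_mk]
    push_cast
    linear_combination (p.1 : ℝ) * s * h1 + p.1 * h2
  · simp only [coords, cross, toPlane, latticePoint, LinearMap.coe_mk, AddHom.coe_mk]
    push_cast
    linear_combination (p.2 : ℝ) * s * h1 + p.2 * h2

theorem coords_injective (h : IsFrame ℓ e d s c) : Function.Injective (coords e d s) := by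
  have h1 := h.det_real
  have h2 := h.sq_real
  have inv : ∀ x : ℝ × ℝ, x = ((coords e d s x).1 * e.1 + (coords e d s x).2 * d.1,
      (coords e d s x).1 * e.2 + (coords e d s x).2 * d.2) := by
    intro x
    ext
    · simp only [coords, cross, toPlane, LinearMap.coe_mk, AddHom.coe_mk]
      linear_combination -(x.1 * s * h1) - x.1 * h2
    · simp only [coords, cross, toPlane, LinearMap.coe_mk, AddHom.coe_mk]
      linear_combination -(x.2 * s * h1) - x.2 * h2
  intro x y hxy
  rw [inv x, inv y, hxy]

theorem injective (h : IsFrame ℓ e d s c) : Function.Injective (latticePoint e d) := by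
  intro p q hpq
  have := congrArg (fun x => coords e d s (toPlane x)) hpq
  simp only [h.coords_latticePoint] at this
  ext
  · exact Int.cast_injective (congrArg Prod.fst this)
  · exact Int.cast_injective (congrArg Prod.snd this)

theorem surjective (h : IsFrame ℓ e d s c) : Function.Surjective (latticePoint e d) := by
  intro x
  have h1 := h.det
  have h2 := h.sq
  refine ⟨(s * (d.1 * x.2 - d.2 * x.1), s * (x.1 * e.2 - x.2 * e.1)), ?_⟩
  ext
  · simp only [latticePoint]
    linear_combination x.1 * s * h1 + x.1 * h2
  · simp only [latticePoint]
    linear_combination x.2 * s * h1 + x.2 * h2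

theorem cross_dir (h : IsFrame ℓ e d s c) (x : ℝ × ℝ) :
    cross ℓ.dir x = c * s * (coords e d s x).1 := by
  have h2 := h.sq_real
  rw [h.dir]
  simp only [coords, cross, LinearMap.coe_mk, AddHom.coe_mk, Prod.smul_fst, Prod.smul_snd,
    smul_eq_mul]
  linear_combination -(c * ((toPlane d).1 * x.2 - (toPlane d).2 * x.1)) * h2

theorem coords_dir (h : IsFrame ℓ e d s c) : coords e d s ℓ.dir = (0, c) := by
  have h1 := h.det_real
  have h2 := h.sq_real
  rw [h.dir]
  ext
  · simp only [coords, cross, toPlane, LinearMap.coe_mk, AddHom.coe_mk, Prod.smul_fst,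
      Prod.smul_snd, smul_eq_mul]
    ring
  · simp only [coords, cross, toPlane, LinearMap.coe_mk, AddHom.coe_mk, Prod.smul_fst,
      Prod.smul_snd, smul_eq_mul]
    linear_combination c * s * h1 + c * h2

variable {A : Type*} {η : ℤ × ℤ → A}

theorem complexity_preimage (h : IsFrame ℓ e d s c) (η : ℤ × ℤ → A) (T : Set (ℤ × ℤ)) :
    complexity (η ∘ latticePoint e d) (latticePoint e d ⁻¹' T) = complexity η T :=
  complexity_congr _ _ h.surjective h.surjective
    (fun p z => by rw [Function.comp_apply, latticePoint_add]) T

theorem complexity_image (h : IsFrame ℓ e d s c) (η : ℤ × ℤ → A) (T : Set (ℤ × ℤ)) :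
    complexity η (latticePoint e d '' T) = complexity (η ∘ latticePoint e d) T := by
  rw [← h.complexity_preimage, Set.preimage_image_eq _ h.injective]

theorem ncard_preimage (h : IsFrame ℓ e d s c) (T : Set (ℤ × ℤ)) :
    (latticePoint e d ⁻¹' T).ncard = T.ncard :=
  Set.ncard_preimage_of_injective_subset_range h.injective fun q _ => h.surjective q

theorem not_periodic (h : IsFrame ℓ e d s c) (hper : ¬ Periodic η) :
    ¬ Periodic (η ∘ latticePoint e d) := by
  rintro ⟨m, hm, hm'⟩
  refine hper ⟨latticePoint e d m, fun h0 => hm (h.injective (h0.trans ?_)), fun x => ?_⟩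
  · simp [latticePoint, Prod.ext_iff]
  · obtain ⟨y, rfl⟩ := h.surjective x
    rw [← latticePoint_add]
    exact hm' y

theorem isVerticallyNonexpansive [TopologicalSpace A] [DiscreteTopology A]
    (h : IsFrame ℓ e d s c) (hℓ : IsNonexpansiveDirection η ℓ) :
    IsVerticallyNonexpansive (η ∘ latticePoint e d) := by
  intro V p hV hp
  obtain ⟨z, z', hag, hne⟩ := hℓ.exists_agree (hV.image (latticePoint e d))
    (p := latticePoint e d p) (by
      rintro _ ⟨v, hv, rfl⟩
      rw [h.cross_dir, h.cross_dir, h.coords_latticePoint, h.coords_latticePoint]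
      exact mul_lt_mul_of_pos_left (Int.cast_lt.2 (hp v hv)) h.pos)
  obtain ⟨z, rfl⟩ := h.surjective z
  obtain ⟨z', rfl⟩ := h.surjective z'
  refine ⟨z, z', fun v hv => ?_, ?_⟩
  · have := hag _ ⟨v, hv, rfl⟩
    rwa [← latticePoint_add, ← latticePoint_add] at this
  · rwa [← latticePoint_add, ← latticePoint_add] at hne

theorem isLatticeConvex_image (h : IsFrame ℓ e d s c) {T : Set (ℤ × ℤ)}
    (hT : IsConvexLattice T) : IsLatticeConvex (latticePoint e d '' T) := by
  obtain ⟨C, hC, hTC⟩ := hT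
  refine Set.Subset.antisymm (fun x hx => subset_convexHull ℝ _ ⟨x, hx, rfl⟩) ?_
  intro x hx
  have hsub : hull (latticePoint e d '' T) ⊆ coords e d s ⁻¹' C := by
    refine convexHull_min ?_ (hC.linear_preimage _)
    rintro _ ⟨_, ⟨t, ht, rfl⟩, rfl⟩
    rw [Set.mem_preimage, h.coords_latticePoint]
    exact (hTC t).1 ht
  obtain ⟨t, rfl⟩ := h.surjective x
  have := hsub hx
  rw [Set.mem_preimage, h.coords_latticePoint] at this
  exact ⟨t, (hTC t).2 this, rfl⟩

/-- The first coordinate is minimal at the point and `σ` breaks ties along its column. For large `K`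
the functional with coefficients `K` and `σ` is minimal there too. Minimality of both pins down the
endpoints of any segment through the point. -/
theorem mem_vertices (h : IsFrame ℓ e d s c) {T : Set (ℤ × ℤ)} (hT : T.Finite) {x y σ : ℤ}
    (hσ : σ ≠ 0) (hmem : (x, y) ∈ T) (hx : ∀ p ∈ T, x ≤ p.1)
    (hy : ∀ p ∈ T, p.1 = x → 0 ≤ σ * (p.2 - y)) :
    latticePoint e d (x, y) ∈ vertices (latticePoint e d '' T) := by
  obtain ⟨K, hK⟩ : ∃ K : ℤ, ∀ p ∈ T, 0 ≤ K * (p.1 - x) + σ * (p.2 - y) := by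
    obtain ⟨M, hM⟩ := (hT.image fun p : ℤ × ℤ => |σ * (p.2 - y)|).bddAbove
    refine ⟨M, fun p hp => ?_⟩
    have h1 := hM ⟨p, hp, rfl⟩
    simp only at h1
    rcases eq_or_lt_of_le (hx p hp) with heq | hlt
    · rw [← heq, sub_self, mul_zero, zero_add]
      exact hy p hp heq.symm
    · have h2 := neg_abs_le (σ * (p.2 - y))
      have h3 := abs_nonneg (σ * (p.2 - y))
      nlinarith [hx p hp]
  set P := toPlane (latticePoint e d (x, y)) with hP
  have hPc : coords e d s P = ((x : ℝ), (y : ℝ)) := h.coords_latticePoint (x, y)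
  have hsub1 : ∀ q ∈ hull (latticePoint e d '' T), (x : ℝ) ≤ (coords e d s q).1 := by
    have : hull (latticePoint e d '' T) ⊆ {q | (x : ℝ) ≤ (coords e d s q).1} := by
      refine convexHull_min ?_
        (convex_halfSpace_ge ((LinearMap.fst ℝ ℝ ℝ ∘ₗ coords e d s).isLinear) _)
      rintro _ ⟨_, ⟨t, ht, rfl⟩, rfl⟩
      rw [Set.mem_ofPred_eq, h.coords_latticePoint]
      exact Int.cast_le.2 (hx t ht)
    exact this
  have hsub2 : ∀ q ∈ hull (latticePoint e d '' T),
      (K * x + σ * y : ℝ) ≤ K * (coords e d s q).1 + σ * (coords e d s q).2 := by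
    have : hull (latticePoint e d '' T) ⊆
        {q | (K * x + σ * y : ℝ) ≤ K * (coords e d s q).1 + σ * (coords e d s q).2} := by
      refine convexHull_min ?_
        (convex_halfSpace_ge (((K : ℝ) • (LinearMap.fst ℝ ℝ ℝ ∘ₗ coords e d s) +
          (σ : ℝ) • (LinearMap.snd ℝ ℝ ℝ ∘ₗ coords e d s)).isLinear) _)
      rintro _ ⟨_, ⟨t, ht, rfl⟩, rfl⟩
      rw [Set.mem_ofPred_eq, h.coords_latticePoint]
      have := hK t ht
      have h' : K * x + σ * y ≤ K * t.1 + σ * t.2 := by linarith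
      simp only [toPlane]
      exact_mod_cast h'
    exact this
  refine ⟨subset_convexHull ℝ _ ⟨_, ⟨_, hmem, rfl⟩, rfl⟩, ?_⟩
  rintro q₁ h₁ q₂ h₂ ⟨α, β, hα, hβ, hαβ, hq⟩
  change α • q₁ + β • q₂ = P at hq
  have hc := congrArg (coords e d s) hq
  rw [map_add, map_smul, map_smul, hPc] at hc
  have hc1 := congrArg Prod.fst hc
  have hc2 := congrArg Prod.snd hc
  simp only [Prod.fst_add, Prod.snd_add, Prod.smul_fst, Prod.smul_snd, smul_eq_mul] at hc1 hc2
  have a1 := hsub1 q₁ h₁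
  have a2 := hsub1 q₂ h₂
  have b1 := hsub2 q₁ h₁
  have b2 := hsub2 q₂ h₂
  have extreme : ∀ {u v m : ℝ}, m ≤ u → m ≤ v → α * u + β * v = m → u = m := by
    intro u v m hu hv hm
    have h3 : α * (u - m) + β * (v - m) = 0 := by linear_combination hm - m * hαβ
    have h4 := mul_nonneg hα.le (sub_nonneg.2 hu)
    have h5 := mul_nonneg hβ.le (sub_nonneg.2 hv)
    have h6 : α * (u - m) = 0 := by linarith
    exact sub_eq_zero.1 ((mul_eq_zero.1 h6).resolve_left hα.ne')
  have e1 := extreme a1 a2 hc1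
  have e2 := extreme b1 b2 (by linear_combination (K : ℝ) * hc1 + σ * hc2)
  have e3 : (coords e d s q₁).2 = y := by
    rw [e1] at e2
    have : (σ : ℝ) * (coords e d s q₁).2 = σ * y := by linarith
    exact mul_left_cancel₀ (by exact_mod_cast hσ) this
  refine h.coords_injective ?_
  rw [hPc]
  exact Prod.ext e1 e3

theorem latticeSegment_eq (h : IsFrame ℓ e d s c) {x u v : ℤ} :
    latticeSegment (latticePoint e d (x, u)) (latticePoint e d (x, v)) =
      latticePoint e d '' vseg x (min u v) (max u v) := by
  ext r
  obtain ⟨⟨x', y'⟩, rfl⟩ := h.surjective r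
  rw [h.injective.mem_set_image]
  have key : (latticePoint e d (x', y') ∈
      latticeSegment (latticePoint e d (x, u)) (latticePoint e d (x, v))) ↔
      toPlane (x', y') ∈ segment ℝ (toPlane (x, u)) (toPlane (x, v)) := by
    have hseg := image_segment ℝ (coords e d s).toAffineMap (toPlane (latticePoint e d (x, u)))
      (toPlane (latticePoint e d (x, v)))
    simp only [LinearMap.coe_toAffineMap, h.coords_latticePoint] at hseg
    rw [← hseg, ← h.coords_latticePoint (x', y'), h.coords_injective.mem_set_image]
    rfl
  rw [key]
  have hvert : segment ℝ (toPlane (x, u)) (toPlane (x, v)) =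
      (fun y : ℝ => ((x : ℝ), y)) '' segment ℝ (u : ℝ) (v : ℝ) :=
    (Prod.image_mk_segment_right (x : ℝ) (u : ℝ) (v : ℝ)).symm
  rw [hvert, segment_eq_uIcc]
  constructor
  · rintro ⟨t, ht, heq⟩
    have h1 : (x : ℝ) = x' := congrArg Prod.fst heq
    have h2 : t = (y' : ℝ) := congrArg Prod.snd heq
    rw [h2, Set.uIcc, Set.mem_Icc, ← Int.cast_min, ← Int.cast_max, Int.cast_le,
      Int.cast_le] at ht
    exact ⟨(Int.cast_injective h1).symm, ht⟩
  · rintro ⟨hx, hy⟩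
    simp only at hx
    subst hx
    refine ⟨y', ?_, rfl⟩
    rw [Set.uIcc, Set.mem_Icc]
    exact_mod_cast hy

/-- On a finite window an element of the orbit closure coincides with a translate of `η`, so testing
positions is enough. -/
theorem isGenerated_image [TopologicalSpace A] [DiscreteTopology A] (h : IsFrame ℓ e d s c)
    {T : Set (ℤ × ℤ)} (hT : T.Finite) {p : ℤ × ℤ} (hp : p ∈ T)
    (hg : Generates (η ∘ latticePoint e d) T p) :
    IsGenerated η (latticePoint e d '' T) (latticePoint e d p) := by
  refine ⟨⟨p, hp, rfl⟩, fun u β hβ heq => ?_⟩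
  obtain ⟨z, hz⟩ := exists_shift_eq_of_mem_orbitClosure hβ (hT.image (latticePoint e d))
  obtain ⟨u, rfl⟩ := h.surjective u
  obtain ⟨z, rfl⟩ := h.surjective z
  have hag : ∀ q ∈ T, q ≠ p → η (latticePoint e d q + latticePoint e d u) =
      β (latticePoint e d q) := fun q hq hqp =>
    heq ⟨⟨q, hq, rfl⟩, fun h' => hqp (h.injective h')⟩
  have hp' := hg u z fun q hq => by
    rw [Function.comp_apply, Function.comp_apply, latticePoint_add, latticePoint_add,
      hag q hq.1 hq.2, hz _ ⟨q, hq.1, rfl⟩]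
  rw [Function.comp_apply, Function.comp_apply, latticePoint_add, latticePoint_add,
    hz _ ⟨p, hp, rfl⟩] at hp'
  rintro _ ⟨q, hq, rfl⟩
  by_cases hqp : q = p
  · rw [hqp]
    exact hp'
  · exact hag q hq hqp

theorem preimage_through_inter (h : IsFrame ℓ e d s c) {T : Set (ℤ × ℤ)} {x : ℝ × ℝ}
    {t : ℤ × ℤ} (ht : toPlane (latticePoint e d t) ∈ ℓ.through x) :
    toPlane ⁻¹' ℓ.through x ∩ latticePoint e d '' T = latticePoint e d '' slice T t.1 := by
  have hc : c ≠ 0 := fun h0 => by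
    have := h.pos
    rw [h0, zero_mul] at this
    exact lt_irrefl _ this
  obtain ⟨τ, hτ⟩ := ht
  have hτ' := congrArg (coords e d s) hτ
  rw [h.coords_latticePoint, map_add, map_smul, h.coords_dir] at hτ'
  ext r
  constructor
  · rintro ⟨⟨τ', h'⟩, q, hq, rfl⟩
    refine ⟨q, ⟨hq, ?_⟩, rfl⟩
    have h'' := congrArg (coords e d s) h'
    rw [h.coords_latticePoint, map_add, map_smul, h.coords_dir] at h''
    have h1 := congrArg Prod.fst hτ'
    have h2 := congrArg Prod.fst h''
    simp only [Prod.fst_add, Prod.smul_fst, smul_zero, add_zero] at h1 h2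
    exact Int.cast_injective (h2.trans h1.symm)
  · rintro ⟨q, ⟨hq, hqt⟩, rfl⟩
    refine ⟨⟨τ + ((q.2 : ℝ) - t.2) / c, ?_⟩, q, hq, rfl⟩
    apply h.coords_injective
    rw [add_smul, ← add_assoc, ← hτ, map_add, map_smul, h.coords_latticePoint,
      h.coords_latticePoint, h.coords_dir]
    ext
    · simp [toPlane, hqt]
    · simp [toPlane, hc]

theorem exists_isBalanced [Finite A] [TopologicalSpace A] [DiscreteTopology A]
    (h : IsFrame ℓ e d s c) (hb : HasVerticalBalanced (η ∘ latticePoint e d)) :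
    ∃ S, IsBalanced η ℓ S := by
  obtain ⟨T, x, a, b, hT, hconv, hab, hx, hslice, ⟨t₀, ht₀, hxt₀⟩, hga, hgb, hlt, hcol⟩ := hb
  have hc : c ≠ 0 := fun h0 => by
    have := h.pos
    rw [h0, zero_mul] at this
    exact lt_irrefl _ this
  have hmem : ∀ y, a ≤ y → y ≤ b → (x, y) ∈ T := by
    intro y h1 h2
    have : (x, y) ∈ slice T x := by
      rw [hslice]
      exact ⟨rfl, h1, h2⟩
    exact this.1
  have hseg : ∀ p ∈ T, p.1 = x → a ≤ p.2 ∧ p.2 ≤ b := by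
    intro p hp hpx
    have : p ∈ vseg x a b := by
      rw [← hslice]
      exact ⟨hp, hpx⟩
    exact this.2
  have hends : ∀ y, y = a ∨ y = b → (x, y) ∈ T ∧
      latticePoint e d (x, y) ∈ vertices (latticePoint e d '' T) ∧
      IsGenerated η (latticePoint e d '' T) (latticePoint e d (x, y)) := by
    rintro y (rfl | rfl)
    · refine ⟨hmem _ le_rfl hab.le, h.mem_vertices hT one_ne_zero (hmem _ le_rfl hab.le) hx ?_,
        h.isGenerated_image hT (hmem _ le_rfl hab.le) hga⟩
      intro p hp hpx
      have := (hseg p hp hpx).1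
      omega
    · refine ⟨hmem _ hab.le le_rfl, h.mem_vertices hT (neg_ne_zero.2 one_ne_zero)
        (hmem _ hab.le le_rfl) hx ?_, h.isGenerated_image hT (hmem _ hab.le le_rfl) hgb⟩
      intro p hp hpx
      have := (hseg p hp hpx).2
      omega
  -- The vector `d` may point against the line, so the sign of `c` decides which endpoint comes
  -- first on the oriented edge.
  obtain ⟨u, v, hu, hv, hmin, hmax, huv⟩ : ∃ u v : ℤ, (u = a ∨ u = b) ∧ (v = a ∨ v = b) ∧
      min u v = a ∧ max u v = b ∧ 0 < ((v : ℝ) - u) / c := by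
    have hab' : (0 : ℝ) < b - a := sub_pos.2 (Int.cast_lt.2 hab)
    rcases lt_or_gt_of_ne hc with hneg | hpos
    · refine ⟨b, a, Or.inr rfl, Or.inl rfl, min_eq_right hab.le, max_eq_left hab.le, ?_⟩
      exact div_pos_of_neg_of_neg (by linarith) hneg
    · exact ⟨a, b, Or.inl rfl, Or.inr rfl, min_eq_left hab.le, max_eq_right hab.le,
        div_pos hab' hpos⟩
  obtain ⟨humem, huvert, hugen⟩ := hends u hu
  obtain ⟨hvmem, hvvert, hvgen⟩ := hends v hv
  set κ : ℝ := ((v : ℝ) - u) / c with hκ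
  have hpar : toPlane (latticePoint e d (x, v)) - toPlane (latticePoint e d (x, u)) =
      κ • ℓ.dir := by
    apply h.coords_injective
    rw [map_sub, map_smul, h.coords_latticePoint, h.coords_latticePoint, h.coords_dir]
    ext
    · simp [toPlane]
    · simp [toPlane, hκ, hc]
  have hcross : ∀ t : ℤ × ℤ, cross
      (toPlane (latticePoint e d (x, v)) - toPlane (latticePoint e d (x, u)))
      (toPlane (latticePoint e d t) - toPlane (latticePoint e d (x, u))) =
      κ * (c * s * ((t.1 : ℝ) - x)) := by
    intro t
    rw [hpar]
    have : ∀ w, cross (κ • ℓ.dir) w = κ * cross ℓ.dir w := by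
      intro w
      simp only [cross, Prod.smul_fst, Prod.smul_snd, smul_eq_mul]
      ring
    rw [this, h.cross_dir, map_sub, h.coords_latticePoint, h.coords_latticePoint]
    rfl
  have hw : latticeSegment (latticePoint e d (x, u)) (latticePoint e d (x, v)) =
      latticePoint e d '' vseg x a b := by
    rw [h.latticeSegment_eq, hmin, hmax]
  have hsub : vseg x a b ⊆ T := by
    rw [← hslice]
    exact slice_subset T x
  have hncard := ncard_vseg x (a := a) (b := b) (by omega)
  refine ⟨latticePoint e d '' T, hT.image _, h.isLatticeConvex_image hconv,
    latticePoint e d (x, u), latticePoint e d (x, v), ⟨?_, huvert, hvvert, ?_, ?_⟩,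
    ⟨κ, huv, hpar⟩, hugen, hvgen, ?_, ?_⟩
  · refine volume_hull_pos ⟨_, humem, rfl⟩ ⟨_, hvmem, rfl⟩ ⟨t₀, ht₀, rfl⟩ ?_
    rw [hcross]
    exact (mul_pos huv (mul_pos h.pos (sub_pos.2 (Int.cast_lt.2 hxt₀)))).ne'
  · intro heq
    have := (Prod.mk.inj (h.injective heq)).2
    omega
  · rintro _ ⟨t, ht, rfl⟩
    rw [hcross]
    exact mul_nonneg huv.le (mul_nonneg h.pos.le (sub_nonneg.2 (Int.cast_le.2 (hx t ht))))
  · rw [hw, ← Set.image_sdiff h.injective]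
    unfold discrepancy
    rw [h.complexity_image, h.complexity_image, Set.ncard_image_of_injective _ h.injective,
      Set.ncard_image_of_injective _ h.injective]
    have := Set.ncard_sdiff_add_ncard_of_subset hsub hT
    omega
  · intro z hz
    obtain ⟨_, hz1, t, ht, rfl⟩ := hz
    rw [h.preimage_through_inter hz1, hw, ← Set.image_inter h.injective,
      Set.inter_eq_left.2 hsub, Set.ncard_image_of_injective _ h.injective,
      Set.ncard_image_of_injective _ h.injective]
    have := hcol t ht
    omega

end IsFrame

end Frames

end Nivat

namespace Nivat

/-! ### The three families of directions. -/

section Directions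

variable {A : Type*} {η : ℤ × ℤ → A} {ℓ : DirectedLine} {e d : ℤ × ℤ} {s : ℤ} {c : ℝ}

theorem mem_preimage_rect {n : ℕ} {x y : ℤ} :
    (x, y) ∈ latticePoint e d ⁻¹' rect n 3 ↔
      (0 ≤ x * e.1 + y * d.1 ∧ x * e.1 + y * d.1 < n) ∧
        0 ≤ x * e.2 + y * d.2 ∧ x * e.2 + y * d.2 < 3 := by
  simp only [rect, latticePoint, Set.mem_preimage, Set.mem_prod, Set.mem_Ico, Nat.cast_ofNat]

theorem isConvexLattice_preimage_rect (n : ℕ) (e d : ℤ × ℤ) :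
    IsConvexLattice (latticePoint e d ⁻¹' rect n 3) := by
  have : latticePoint e d ⁻¹' rect n 3 = {p | (-e.1) * p.1 + (-d.1) * p.2 ≤ 0} ∩
      ({p | e.1 * p.1 + d.1 * p.2 ≤ n - 1} ∩ ({p | (-e.2) * p.1 + (-d.2) * p.2 ≤ 0} ∩
        {p | e.2 * p.1 + d.2 * p.2 ≤ 2})) := by
    ext ⟨x, y⟩
    rw [mem_preimage_rect]
    simp only [Set.mem_inter_iff, Set.mem_ofPred_eq, mul_comm x, mul_comm y, neg_mul]
    omega
  rw [this]
  exact (isConvexLattice_halfPlane _ _ _).inter ((isConvexLattice_halfPlane _ _ _).inter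
    ((isConvexLattice_halfPlane _ _ _).inter (isConvexLattice_halfPlane _ _ _)))

theorem IsFrame.finite_preimage_rect (h : IsFrame ℓ e d s c) (n : ℕ) :
    (latticePoint e d ⁻¹' rect n 3).Finite :=
  (rect_finite n 3).preimage h.injective.injOn

variable [Finite A] [TopologicalSpace A] [DiscreteTopology A]

theorem lt_complexity_rect_of_slices (h : IsFrame ℓ e d s c) (hℓ : IsNonexpansiveDirection η ℓ)
    (hper : ¬ Periodic η) (hno : ¬ ∃ S, IsBalanced η ℓ S) {n : ℕ}
    (hcol : ∀ p ∈ latticePoint e d ⁻¹' rect n 3, ∀ q ∈ latticePoint e d ⁻¹' rect n 3,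
      (slice (latticePoint e d ⁻¹' rect n 3) p.1).ncard ≤
        (slice (latticePoint e d ⁻¹' rect n 3) q.1).ncard + 1) :
    n * 3 < complexity η (rect n 3) := by
  have := ncard_lt_complexity (h.isVerticallyNonexpansive hℓ)
    (fun hb => hno (h.exists_isBalanced hb)) (h.not_periodic hper) (h.finite_preimage_rect n)
    (isConvexLattice_preimage_rect n e d) fun p hp q hq _ => hcol p hp q hq
  rwa [h.complexity_preimage, h.ncard_preimage, ncard_rect] at this

theorem exists_sign (hc : c ≠ 0) : ∃ s : ℤ, (s = 1 ∨ s = -1) ∧ 0 < c * s := by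
  rcases lt_or_gt_of_ne hc with h | h
  · exact ⟨-1, Or.inr rfl, by push_cast; linarith⟩
  · exact ⟨1, Or.inl rfl, by push_cast; linarith⟩

/-- The columns are the rows of the rectangle, all of length `n`. -/
theorem lt_complexity_rect_of_horizontal (hℓ : IsNonexpansiveDirection η ℓ)
    (hper : ¬ Periodic η) (hno : ¬ ∃ S, IsBalanced η ℓ S) (hc : c ≠ 0)
    (hdir : ℓ.dir = c • toPlane (1, 0)) (n : ℕ) : n * 3 < complexity η (rect n 3) := by
  obtain ⟨s, hs, hcs⟩ := exists_sign hc
  have h : IsFrame ℓ (0, s) (1, 0) s c :=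
    ⟨by simp, by rcases hs with rfl | rfl <;> norm_num, hdir, hcs⟩
  refine lt_complexity_rect_of_slices h hℓ hper hno ?_
  rintro ⟨x, y⟩ - ⟨x', y'⟩ hq
  rw [mem_preimage_rect] at hq
  simp only [mul_zero, mul_one, add_zero, zero_add] at hq
  have h1 := ncard_slice_le (T := latticePoint (0, s) (1, 0) ⁻¹' rect n 3) (x := x) (a := 0)
    (b := n - 1) (by omega) ?_
  · have h2 := le_ncard_slice (h.finite_preimage_rect n) (x := x') (a := 0) (b := n - 1)
      (by omega) ?_
    · simp only
      omega
    · intro y h1 h2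
      rw [mem_preimage_rect]
      simp only [mul_zero, mul_one, add_zero, zero_add]
      omega
  · rintro ⟨x, y⟩ hp -
    rw [mem_preimage_rect] at hp
    simp only [mul_zero, mul_one, add_zero, zero_add] at hp ⊢
    omega

/-- A step along the direction changes the row by two, so a line meets the three rows in at most two
points. -/
theorem lt_complexity_rect_of_odd (hℓ : IsNonexpansiveDirection η ℓ)
    (hper : ¬ Periodic η) (hno : ¬ ∃ S, IsBalanced η ℓ S) (hc : c ≠ 0) {m : ℤ}
    (hdir : ℓ.dir = c • toPlane (2 * m + 1, 2)) (n : ℕ) : n * 3 < complexity η (rect n 3) := by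
  obtain ⟨s, hs, hcs⟩ := exists_sign hc
  have h : IsFrame ℓ (s * m, s) (2 * m + 1, 2) s c :=
    ⟨by ring, by rcases hs with rfl | rfl <;> norm_num, hdir, hcs⟩
  refine lt_complexity_rect_of_slices h hℓ hper hno ?_
  rintro p - q hq
  have h2 := one_le_ncard_slice (h.finite_preimage_rect n) hq
  have h1 := ncard_slice_le (T := latticePoint (s * m, s) (2 * m + 1, 2) ⁻¹' rect n 3) (x := p.1)
    (a := (1 - p.1 * s) / 2) (b := (1 - p.1 * s) / 2 + 1) (by omega) ?_
  · omega
  · rintro ⟨x, y⟩ hp hx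
    rw [mem_preimage_rect] at hp
    simp only at hp hx ⊢
    subst hx
    omega

theorem lt_complexity_rect_of_slanted (hℓ : IsNonexpansiveDirection η ℓ)
    (hper : ¬ Periodic η) (hno : ¬ ∃ S, IsBalanced η ℓ S) (hc : c ≠ 0) {α : ℤ}
    (hdir : ℓ.dir = c • toPlane (α, 1)) (n : ℕ) : n * 3 < complexity η (rect n 3) := by
  -- The sign `i` puts the first basis vector to the left of the line. The sign `ε` below makes the
  -- shear `i * (ε * α)` nonnegative.
  obtain ⟨i, hi, hci⟩ : ∃ i : ℤ, (i = 1 ∨ i = -1) ∧ 0 < c * (-i : ℤ) := by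
    obtain ⟨s, hs, hcs⟩ := exists_sign hc
    exact ⟨-s, by omega, by rwa [neg_neg]⟩
  obtain ⟨ε, hε, hα⟩ : ∃ ε : ℤ, (ε = 1 ∨ ε = -1) ∧ 0 ≤ i * (ε * α) := by
    rcases le_total 0 (i * α) with h | h
    · exact ⟨1, Or.inl rfl, by rwa [one_mul]⟩
    · exact ⟨-1, Or.inr rfl, by rw [neg_one_mul, mul_neg]; omega⟩
  have hε2 : ε * ε = 1 := by rcases hε with rfl | rfl <;> norm_num
  have hi2 : i * i = 1 := by rcases hi with rfl | rfl <;> norm_num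
  have hε2' : (ε : ℝ) * ε = 1 := by exact_mod_cast hε2
  have h : IsFrame ℓ (i, 0) (ε * α, ε) (-(ε * i)) (c * ε) := by
    refine ⟨by ring, by linear_combination i * i * hε2 + hi2, ?_, ?_⟩
    · rw [hdir]
      ext
      · simp only [toPlane, Prod.smul_fst, smul_eq_mul]
        push_cast
        linear_combination -(c * α) * hε2'
      · simp only [toPlane, Prod.smul_snd, smul_eq_mul]
        push_cast
        linear_combination -c * hε2'
    · push_cast at hci ⊢
      have : c * ε * -(ε * i) = c * -i * (ε * ε) := by ring
      rw [this, hε2', mul_one]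
      exact hci
  obtain ⟨k, hk⟩ := Int.eq_ofNat_of_zero_le hα
  have key := ncard_shearedRect_lt_complexity (h.isVerticallyNonexpansive hℓ)
    (fun hb => hno (h.exists_isBalanced hb)) (h.not_periodic hper) (N := n - 1) k 0 le_rfl
    (by rw [zero_add, ← hk]) (-(2 * (i * (ε * α))))
  -- For `L = -(2 * a)` and `J = 0`, with `a` the shear, nothing is cut off. The translation
  -- compensates for the reflections caused by `ε = -1` and `i = -1`.
  have htr : ∃ v : ℤ × ℤ, {p | p + v ∈ latticePoint (i, 0) (ε * α, ε) ⁻¹' rect n 3} =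
      shearedRect (i * (ε * α)) (n - 1) 0 (-(2 * (i * (ε * α)))) := by
    refine ⟨(i * (ε * α) * (1 - ε) - (if i = 1 then 0 else (n : ℤ) - 1), ε - 1), ?_⟩
    ext ⟨x, y⟩
    rw [Set.mem_ofPred_eq, Prod.mk_add_mk, mem_preimage_rect]
    simp only [shearedRect, Set.mem_ofPred_eq]
    constructor
    · intro hmem
      have hy : 0 ≤ y ∧ y ≤ 2 := by
        rcases hε with rfl | rfl <;> omega
      obtain ⟨hy1, hy2⟩ := hy
      rcases hε with rfl | rfl <;> rcases hi with rfl | rfl <;> norm_num at hmem hα ⊢ <;>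
        interval_cases y <;> omega
    · rintro ⟨hx, ⟨rfl, hmem⟩ | ⟨rfl, hmem⟩ | ⟨rfl, hmem⟩⟩ <;>
      rcases hε with rfl | rfl <;> rcases hi with rfl | rfl <;> norm_num at hmem hα ⊢ <;> omega
  obtain ⟨v, hv⟩ := htr
  rw [← hv, ncard_translate, complexity_translate, h.complexity_preimage, h.ncard_preimage,
    ncard_rect] at key
  exact key

end Directions

end Nivat

theorem mainTheorem6 {A : Type*} [Finite A] [Nontrivial A] [TopologicalSpace A]
    [DiscreteTopology A] (η : ℤ × ℤ → A)
    (hη : ∃ n : ℕ, complexity η (rect n 3) ≤ 3 * n)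
    (ℓ : DirectedLine) (hℓ : IsNonexpansiveDirection η ℓ)
    (haper : ¬ Nivat.Periodic η) :
    ∃ S : Set (ℤ × ℤ), IsBalanced η ℓ S := by
  by_contra hno
  obtain ⟨n, hn⟩ := hη
  have hlt : n * 3 < complexity η (rect n 3) := by
    by_cases hinj : Set.InjOn (fun q => cross ℓ.dir (toPlane q)) (rect n 3)
    · have := hℓ.ncard_lt_complexity (rect_finite n 3) hinj
      rwa [ncard_rect] at this
    · obtain ⟨c, hc, h | ⟨α, h⟩ | ⟨m, h⟩⟩ := exists_smul_of_cross_eq ℓ.dir_ne_zero hinj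
      · exact lt_complexity_rect_of_horizontal hℓ haper hno hc h n
      · exact lt_complexity_rect_of_slanted hℓ haper hno hc h n
      · exact lt_complexity_rect_of_odd hℓ haper hno hc h n
  omega
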